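/- \textbf{Setting.} Let $\sigma(z)=\max\{z,0\}$ and consider the two-layer network with $m$ hidden units $f_{W,a}(x)=\frac1{\sqrt m}\sum_{r=1}^m a_r\,\sigma(w_r^\top x)$, $W=(w_1,\dots,w_m)\in\mathbb R^{d\times m}$. Let $(x_{P,i},y_{P,i})_{i=1}^{n_P}$ (source) and $(x_{Q,i},y_{Q,i})_{i=1}^{n_Q}$ (target) be data sets in $\mathbb R^d\times\mathbb R$ with $\|x\|_2=1$ and $|y|\le 1$ for every sample $(x,y)$. The weights are initialized independently by $w_r(0)\sim\mathcal N(0,\kappa^2 I)$, $a_r\sim\mathrm{unif}\{-1,1\}$, with $\kappa>0$. With $a$ kept fixed, $W$ is trained by full-batch gradient descent with learning rate $\eta>0$ on the squared loss $\frac12\sum_i (y_i-f_{W,a}(x_i))^2$ (with the convention $\sigma'(z)=\mathbb I\{z\ge 0\}$): $K_P$ steps on the source data starting from $W(0)$ give $W(P)$, and then $K_Q$ steps on the target data starting from $W(P)$ give $W(Q)$. For $A,B\in\{P,Q\}$ put $$(H_{AB}^\infty)_{ij}=\mathbb E_{w\sim\mathcal N(0,I)}\big[x_{A,i}^\top x_{B,j}\,\mathbb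 I\{w^\top x_{A,i}\ge 0,\ w^\top x_{B,j}\ge 0\}\big],$$ $H_P^\infty=H_{PP}^\infty$, $H_Q^\infty=H_{QQ}^\infty$, let $\lambda_P$ and $\lambda_Q$ be the smallest eigenvalues of $H_P^\infty$ and $H_Q^\infty$, assumed positive, and let $y_{P\to Q}=(H_{PQ}^\infty)^\top (H_P^\infty)^{-1}y_P$. \textbf{Theorem.} There is a universal constant $c>0$ such that for every $c_\kappa>0$ there are a constant $C>0$ and polynomials $p_1,p_2$ in six variables, depending only on $c_\kappa$, with the following property. In the setting above let $0<\delta<1$ and suppose that $$\kappa\le c_\kappa\,\frac{\lambda_P^2\lambda_Q^2\,\delta}{n_P^2\,n_Q^{1/2}},\qquad \eta\le c\,\frac{\lambda_P}{n_P^2},\qquad \eta\le c\,\frac{\lambda_Q}{n_Q^2},\qquad m\ge p_1(n_P,n_Q,\delta^{-1},\lambda_P^{-1},\lambda_Q^{-1},\kappa^{-1}).$$ Then with probability at least $1-\delta$ over the random initialization, simultaneously for all numbers of steps $K_P\ge \frac{\log m}{\eta\lambda_P}$ and $K_Q\ge 0$, $$\|W(Q)-W(P)\|_F\le\sqrt{(y_Q-y_{P\to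 Q})^\top (H_Q^\infty)^{-1}(y_Q-y_{P\to Q})}+C\,\frac{n_P\,n_Q^{1/2}\,\kappa^{1/2}}{\lambda_P\lambda_Q\,\delta^{1/2}}+\frac{p_2(n_P,n_Q,\delta^{-1},\lambda_P^{-1},\lambda_Q^{-1},\kappa^{-1})}{m^{1/4}}.$$ -/

import Mathlib

open MeasureTheory ProbabilityTheory Matrix

noncomputable section

namespace TransferReLU

/-- Inputs live in `ℝ^d` with the Euclidean norm. -/
abbrev Input (d : ℕ) : Type := EuclideanSpace ℝ (Fin d)

/-- A weight matrix `W = (w_1, …, w_m) ∈ ℝ^{d × m}`, given by its columns. -/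
abbrev Weights (d m : ℕ) : Type := Fin m → Input d

/-- The ReLU activation. -/
def relu (z : ℝ) : ℝ := max z 0

/-- The two-layer network `f_{W,a}(x) = m^{-1/2} ∑_r a_r σ(w_rᵀ x)`. -/
def network {d m : ℕ} (a : Fin m → ℝ) (W : Weights d m) (x : Input d) : ℝ :=
  (1 / √(m : ℝ)) * ∑ r, a r * relu (inner ℝ (W r) x)

/-- The squared loss `L(W) = ½ ∑_i (y_i - f_{W,a}(x_i))²`. -/
def loss {d m n : ℕ} (a : Fin m → ℝ) (x : Fin n → Input d) (y : Fin n → ℝ)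
    (W : Weights d m) : ℝ :=
  (1 / 2) * ∑ i, (y i - network a W (x i)) ^ 2

/-- The gradient of the loss with respect to `w_r`, with the convention `σ'(z) = 𝕀{z ≥ 0}`:
`∂L/∂w_r = m^{-1/2} ∑_i (f_{W,a}(x_i) - y_i) a_r 𝕀{w_rᵀ x_i ≥ 0} x_i`. -/
def lossGrad {d m n : ℕ} (a : Fin m → ℝ) (x : Fin n → Input d) (y : Fin n → ℝ)
    (W : Weights d m) : Weights d m := fun r =>
  (1 / √(m : ℝ)) • ∑ i, ((network a W (x i) - y i) * a r *
    (if 0 ≤ inner ℝ (W r) (x i) then 1 else 0)) • x i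

/-- Away from the kink of the activation, `lossGrad` is the gradient of `loss`. -/
theorem hasGradientAt_loss {d m n : ℕ} (a : Fin m → ℝ) (x : Fin n → Input d) (y : Fin n → ℝ)
    (W : Weights d m) (r : Fin m) (h : ∀ i, inner ℝ (W r) (x i) ≠ (0 : ℝ)) :
    HasGradientAt (fun w => loss a x y (Function.update W r w)) (lossGrad a x y W r) (W r) := by
  have hrelu : ∀ z : ℝ, z ≠ 0 → HasDerivAt relu (if 0 ≤ z then 1 else 0) z := by
    intro z hz
    rcases lt_or_gt_of_ne hz with hz | hz
    · rw [if_neg (not_le.2 hz)]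
      refine (hasDerivAt_const z (0 : ℝ)).congr_of_eventuallyEq ?_
      filter_upwards [gt_mem_nhds hz] with t ht
      exact max_eq_right ht.le
    · rw [if_pos hz.le]
      refine (hasDerivAt_id z).congr_of_eventuallyEq ?_
      filter_upwards [lt_mem_nhds hz] with t ht
      exact max_eq_left ht.le
  have hin : ∀ i, HasFDerivAt (fun w : Input d => (inner ℝ w (x i) : ℝ))
      (innerSL ℝ (x i)) (W r) := by
    intro i
    refine ((innerSL ℝ (x i)).hasFDerivAt (x := W r)).congr_of_eventuallyEq ?_
    exact Filter.Eventually.of_forall fun w => by simp [real_inner_comm]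
  have hnet : ∀ i, HasFDerivAt (fun w => network a (Function.update W r w) (x i))
      ((1 / √(m : ℝ)) • (a r • ((if 0 ≤ (inner ℝ (W r) (x i) : ℝ) then (1 : ℝ) else 0) •
        innerSL ℝ (x i)))) (W r) := by
    intro i
    have h1 := (((hrelu _ (h i)).comp_hasFDerivAt (W r) (hin i)).const_smul (a r)).add_const
      (∑ s ∈ Finset.univ.erase r, a s * relu (inner ℝ (W s) (x i)))
    refine (h1.const_smul (1 / √(m : ℝ))).congr_of_eventuallyEq ?_
    refine Filter.Eventually.of_forall fun w => ?_
    simp only [network, Pi.smul_apply, smul_eq_mul, Function.comp]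
    rw [← Finset.add_sum_erase _ _ (Finset.mem_univ r)]
    congr 2
    · simp
    · refine Finset.sum_congr rfl fun s hs => ?_
      rw [Function.update_of_ne (Finset.ne_of_mem_erase hs)]
  have hloss := (HasFDerivAt.fun_sum (u := Finset.univ)
    fun i _ => ((hnet i).const_sub (y i)).pow 2).const_smul (1 / 2 : ℝ)
  rw [hasGradientAt_iff_hasFDerivAt]
  refine HasFDerivAt.congr_fderiv hloss (ContinuousLinearMap.ext fun v => ?_)
  simp only [lossGrad, InnerProductSpace.toDual_apply_apply, Function.update_eq_self,
    real_inner_smul_left, sum_inner, _root_.smul_apply, _root_.sum_apply,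
    _root_.neg_apply, innerSL_apply_apply, smul_eq_mul, Finset.mul_sum]
  refine Finset.sum_congr rfl fun i _ => ?_
  by_cases hi : 0 ≤ (inner ℝ (W r) (x i) : ℝ)
  · simp [hi]
    ring
  · simp [hi]

/-- The weights after `k` steps of (full-batch) gradient descent on the data `(x, y)` with
learning rate `η`, started at `W₀`; the output weights `a` are kept fixed. -/
def gradDescent {d m n : ℕ} (a : Fin m → ℝ) (x : Fin n → Input d) (y : Fin n → ℝ) (η : ℝ)
    (W₀ : Weights d m) (k : ℕ) : Weights d m :=
  (fun W => W - η • lossGrad a x y W)^[k] W₀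

/-- The law of the random initialization `(W(0), a)`: all `w_r ~ N(0, κ² I)` and
`a_r ~ unif {-1, 1}` are independent. -/
def initLaw (d m : ℕ) (κ : ℝ) : Measure (Weights d m × (Fin m → ℝ)) :=
  (Measure.pi fun _ : Fin m => multivariateGaussian (0 : Input d) (κ ^ 2 • 1)).prod
    (Measure.pi fun _ : Fin m => uniformOn ({-1, 1} : Set ℝ))

/-- The limiting Gram matrix
`H^∞_{ij} = 𝔼_{w ~ N(0, I)} [x_iᵀ x'_j 𝕀{wᵀ x_i ≥ 0, wᵀ x'_j ≥ 0}]`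
of two families of inputs. -/
def gramInf {d n n' : ℕ} (x : Fin n → Input d) (x' : Fin n' → Input d) :
    Matrix (Fin n) (Fin n') ℝ :=
  Matrix.of fun i j => ∫ w, inner ℝ (x i) (x' j) *
    (if 0 ≤ inner ℝ w (x i) ∧ 0 ≤ inner ℝ w (x' j) then (1 : ℝ) else 0)
      ∂(stdGaussian (Input d))

/-- The source labels transformed to the target: `y_{P→Q} = (H_PQ^∞)ᵀ (H_P^∞)⁻¹ y_P`. -/
def transferredLabel {d nP nQ : ℕ} (xP : Fin nP → Input d) (yP : Fin nP → ℝ)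
    (xQ : Fin nQ → Input d) : Fin nQ → ℝ :=
  (gramInf xP xQ)ᵀ *ᵥ ((gramInf xP xP)⁻¹ *ᵥ yP)

/-- The Frobenius norm of a weight matrix. -/
def frobNorm {d m : ℕ} (W : Weights d m) : ℝ := √(∑ r, ‖W r‖ ^ 2)

/-- The value of a polynomial in six variables at
`(n_P, n_Q, δ⁻¹, λ_P⁻¹, λ_Q⁻¹, κ⁻¹)`. -/
def polyBound (p : MvPolynomial (Fin 6) ℝ) (nP nQ : ℕ) (δ lamP lamQ κ : ℝ) : ℝ :=
  MvPolynomial.eval ![(nP : ℝ), (nQ : ℝ), δ⁻¹, lamP⁻¹, lamQ⁻¹, κ⁻¹] p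

end TransferReLU

end

open TransferReLU

open MeasureTheory ProbabilityTheory Matrix

noncomputable section

namespace TransferReLU

/-! The proof is a lazy-training argument: both stages of gradient descent are compared with the
linearization of the network at the initialization `W₀`. Each hidden unit moves only by `O(1/√m)`,
so only units whose preactivation at a sample is within a radius `R ~ 1/√m` of the kink can switch.
Their proportion is of order `R/κ`, and the features move by its square root; this is the origin of
the rate `m^{-1/4}`, written `τ` up to polynomial factors. Up to relative errors `τ`, the residuals
obey `r ↦ r - η H r` with `H` the limiting Gram matrix, and the weights move by `-∑ T_j feat(x_j)`
with `T = η ∑ r_k` (`gradDescent_stage`).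

On the source the residual decays to order `τ`, hence `H_P T ≈ r_P(0)`. The target outputs then
change by about `-H_PQᵀ H_P⁻¹ r_P(0)`, so the target residual becomes `-(y_Q - y_{P→Q})` plus a term
from the network output at initialization, of order `κ` (`norm_transferred_residual_le`).

On the target the squared displacement is about `⟨H T, T⟩`. For exact linear descent from residual
`H S` one has `H T = H S - r_K` and `⟨r_K, T⟩ ≥ 0`, because iterates of one self-adjoint contraction
have nonnegative inner products. Cauchy–Schwarz in the energy form then bounds the energy of `T` by
that of `S`, for every number of steps and with constant one (`Coercive.energy_sum_le`). With `S =
H_Q⁻¹ r` this energy is the square root in the theorem, plus the energy of the error.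

Randomness enters through seven events: small outputs, accurate Gram matrices and few units near the
kink. Each follows from a first or second moment and Markov's inequality, which is enough since
polynomial dependence on `δ⁻¹` is allowed. None of them mentions the numbers of steps, which gives
the uniformity in `KP` and `KQ`. -/

/-- Total length of a geometrically decaying sequence. -/
theorem eta_mul_sum_norm_le {F : Type*} [SeminormedAddCommGroup F] {r : ℕ → F} {K : ℕ}
    {lam η : ℝ} (hlam : 0 < lam) (hη : 0 < η)
    (hηlam : η * lam ≤ 1)
    (hr : ∀ k < K, ‖r k‖ ≤ (1 - η * lam / 4) ^ k * ‖r 0‖) :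
    η * ∑ k ∈ Finset.range K, ‖r k‖ ≤ 4 / lam * ‖r 0‖ := by
  have h1 : ∑ k ∈ Finset.range K, ‖r k‖ ≤
      (∑ k ∈ Finset.range K, (1 - η * lam / 4) ^ k) * ‖r 0‖ := by
    rw [Finset.sum_mul]
    exact Finset.sum_le_sum fun k hk => hr k (Finset.mem_range.1 hk)
  have hpos : 0 < η * lam := by positivity
  have h2 : ∑ k ∈ Finset.range K, (1 - η * lam / 4) ^ k ≤ 4 / (η * lam) := by
    have := mul_neg_geom_sum (1 - η * lam / 4) K
    have h3 : 0 ≤ (1 - η * lam / 4) ^ K := pow_nonneg (by linarith) _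
    rw [le_div_iff₀ hpos]
    linarith
  calc η * ∑ k ∈ Finset.range K, ‖r k‖ ≤ η * (4 / (η * lam) * ‖r 0‖) := by
        gcongr
        exact h1.trans (by gcongr)
    _ = _ := by field_simp

/-! ### Exact and perturbed gradient descent on a quadratic form. -/

section Abstract

variable {E : Type*} [NormedAddCommGroup E] [InnerProductSpace ℝ E]

/-- Residuals after `k` steps of exact gradient descent on a quadratic form. -/
def linRes (H : E →L[ℝ] E) (η : ℝ) (r : E) (k : ℕ) : E := (fun v => v - η • H v)^[k] r

theorem linRes_succ (H : E →L[ℝ] E) (η : ℝ) (r : E) (k : ℕ) :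
    linRes H η r (k + 1) = linRes H η r k - η • H (linRes H η r k) := by
  simp [linRes, Function.iterate_succ_apply']

/-- A symmetric operator whose spectrum lies in `[lam, L]`. -/
structure Coercive (H : E →L[ℝ] E) (lam L : ℝ) : Prop where
  symm : ∀ v w, inner ℝ (H v) w = (inner ℝ v (H w) : ℝ)
  lower : ∀ v, lam * ‖v‖ ^ 2 ≤ inner ℝ (H v) v
  upper : ∀ v, ‖H v‖ ≤ L * ‖v‖

variable {H : E →L[ℝ] E} {lam L η : ℝ}

theorem Coercive.nonneg (h : Coercive H lam L) (hlam : 0 < lam) (v : E) :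
    (0 : ℝ) ≤ inner ℝ (H v) v :=
  le_trans (by positivity) (h.lower v)

theorem Coercive.le_norm (h : Coercive H lam L) (v : E) : lam * ‖v‖ ≤ ‖H v‖ := by
  rcases (norm_nonneg v).eq_or_lt with h0 | h0
  · rw [← h0]; simp
  · have := (h.lower v).trans (real_inner_le_norm _ _)
    nlinarith

/-- In the expansion of the square, `η * L ^ 2 ≤ lam` makes the quadratic term cancel at most half
of the linear gain `2ηλ`. What remains is `1 - ηλ ≤ (1 - ηλ/2)²`. -/
theorem Coercive.contract (h : Coercive H lam L) (hη : 0 < η) (hηL : η * L ^ 2 ≤ lam)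
    (hηlam : η * lam ≤ 1) (v : E) :
    ‖v - η • H v‖ ≤ (1 - η * lam / 2) * ‖v‖ := by
  have h1 : ‖v - η • H v‖ ^ 2 = ‖v‖ ^ 2 - 2 * η * inner ℝ (H v) v + η ^ 2 * ‖H v‖ ^ 2 := by
    rw [norm_sub_sq_real, real_inner_smul_right, norm_smul, Real.norm_of_nonneg hη.le,
      real_inner_comm]
    ring
  have h2 : ‖H v‖ ^ 2 ≤ L ^ 2 * ‖v‖ ^ 2 := by
    rw [← mul_pow]; exact pow_le_pow_left₀ (norm_nonneg _) (h.upper v) 2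
  have h3 : η ^ 2 * ‖H v‖ ^ 2 ≤ η * lam * ‖v‖ ^ 2 := by
    calc η ^ 2 * ‖H v‖ ^ 2 ≤ η ^ 2 * (L ^ 2 * ‖v‖ ^ 2) := by gcongr
      _ = η * (η * L ^ 2) * ‖v‖ ^ 2 := by ring
      _ ≤ _ := by gcongr
  refine abs_le_of_sq_le_sq' ?_ (by have := norm_nonneg v; nlinarith) |>.2
  rw [h1]
  have := h.lower v
  nlinarith [sq_nonneg (η * lam * ‖v‖), mul_le_mul_of_nonneg_left this hη.le]

/-- By symmetry of `H` a step can be moved from one argument to the other, so the inner product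
depends only on `j + k`. An even sum gives a squared norm, an odd one gives `⟨v - ηHv, v⟩`,
nonnegative since `η * L ≤ 1`. -/
theorem Coercive.inner_linRes_nonneg (h : Coercive H lam L) (hη : 0 < η) (hηL : η * L ≤ 1)
    (r : E) (j k : ℕ) : (0 : ℝ) ≤ inner ℝ (linRes H η r j) (linRes H η r k) := by
  have hshift : ∀ j k, (inner ℝ (linRes H η r (j + 1)) (linRes H η r k) : ℝ) =
      inner ℝ (linRes H η r j) (linRes H η r (k + 1)) := by
    intro j k
    simp only [linRes_succ, inner_sub_left, inner_sub_right, real_inner_smul_left,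
      real_inner_smul_right, h.symm]
  have hdiag : ∀ s j k, j + k = s →
      (0 : ℝ) ≤ inner ℝ (linRes H η r j) (linRes H η r k) := by
    have hstep : ∀ i j k, (inner ℝ (linRes H η r (j + i)) (linRes H η r k) : ℝ) =
        inner ℝ (linRes H η r j) (linRes H η r (k + i)) := by
      intro i
      induction i with
      | zero => intro j k; rfl
      | succ i ih => intro j k; rw [← add_assoc, hshift, ih]; congr 2; omega
    intro s j k hs
    obtain ⟨t, ht⟩ := Nat.even_or_odd' s
    have hto : ∀ j k j' k' : ℕ, j + k = j' + k' → j' ≤ j →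
        (inner ℝ (linRes H η r j) (linRes H η r k) : ℝ) =
          inner ℝ (linRes H η r j') (linRes H η r k') := by
      intro j k j' k' h1 h2
      obtain ⟨i, rfl⟩ := Nat.exists_eq_add_of_le h2
      rw [hstep i j' k]; congr 2; omega
    have hto' : ∀ j k j' k' : ℕ, j + k = j' + k' →
        (inner ℝ (linRes H η r j) (linRes H η r k) : ℝ) =
          inner ℝ (linRes H η r j') (linRes H η r k') := by
      intro j k j' k' h1
      rcases le_total j' j with h2 | h2
      · exact hto _ _ _ _ h1 h2
      · exact (hto _ _ _ _ h1.symm h2).symm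
    rcases ht with ht | ht
    · rw [hto' j k t t (by omega)]; exact real_inner_self_nonneg
    · rw [hto' j k (t + 1) t (by omega), linRes_succ]
      set v := linRes H η r t
      rw [inner_sub_left, real_inner_smul_left, real_inner_self_eq_norm_sq]
      have h1 := real_inner_le_norm (H v) v
      have h2 := h.upper v
      have h3 : inner ℝ (H v) v ≤ L * ‖v‖ ^ 2 := by
        refine h1.trans ?_
        rw [pow_two, ← mul_assoc]
        gcongr
      have h4 : η * inner ℝ (H v) v ≤ η * (L * ‖v‖ ^ 2) := by gcongr
      nlinarith [sq_nonneg ‖v‖]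
  exact hdiag _ _ _ rfl

/-- `√⟨S, H S⟩`, the energy norm of `S`. -/
def energy (H : E →L[ℝ] E) (S : E) : ℝ := √(inner ℝ (H S) S)

/-- Cauchy–Schwarz for the form `⟨H v, w⟩`, from the discriminant of `t ↦ ⟨H(tv + w), tv + w⟩ ≥ 0`.
-/
theorem Coercive.inner_le_energy (h : Coercive H lam L) (hlam : 0 < lam) (v w : E) :
    inner ℝ (H v) w ≤ energy H v * energy H w := by
  have hv := h.nonneg hlam v
  have hw := h.nonneg hlam w
  rw [energy, energy, ← Real.sqrt_mul hv]
  refine Real.le_sqrt_of_sq_le ?_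
  have key : ∀ t : ℝ, 0 ≤ inner ℝ (H v) v * (t * t) + (2 * inner ℝ (H v) w) * t
      + inner ℝ (H w) w := by
    intro t
    have := h.nonneg hlam (t • v + w)
    simp only [map_add, map_smul, inner_add_left, inner_add_right, real_inner_smul_left,
      real_inner_smul_right] at this
    have hs : (inner ℝ (H w) v : ℝ) = inner ℝ (H v) w := by
      rw [h.symm, real_inner_comm]
    rw [hs] at this
    linarith
  have := discrim_le_zero key
  rw [discrim] at this
  nlinarith

theorem Coercive.energy_sq (h : Coercive H lam L) (hlam : 0 < lam) (v : E) :
    energy H v ^ 2 = inner ℝ (H v) v := Real.sq_sqrt (h.nonneg hlam v)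

theorem energy_nonneg (v : E) : 0 ≤ energy H v := Real.sqrt_nonneg _

theorem Coercive.energy_add_le (h : Coercive H lam L) (hlam : 0 < lam) (v w : E) :
    energy H (v + w) ≤ energy H v + energy H w := by
  refine abs_le_of_sq_le_sq' ?_ (add_nonneg (energy_nonneg _) (energy_nonneg _)) |>.2
  rw [h.energy_sq hlam, map_add, inner_add_left, inner_add_right, inner_add_right]
  have h1 := h.inner_le_energy hlam v w
  have h2 := h.inner_le_energy hlam w v
  have := h.energy_sq hlam v
  have := h.energy_sq hlam w
  nlinarith

/-- Coercivity alone would give `√lam` in the denominator; `lam ≤ 1` weakens it to `lam`, the power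
that appears in the theorem. -/
theorem Coercive.energy_le (h : Coercive H lam L) (hlam : 0 < lam) (hlam1 : lam ≤ 1) (S : E) :
    energy H S ≤ ‖H S‖ / lam := by
  refine Real.sqrt_le_iff.2 ⟨by positivity, ?_⟩
  have h1 := real_inner_le_norm (H S) S
  have h2 := h.le_norm S
  rw [div_pow, le_div_iff₀ (by positivity)]
  calc inner ℝ (H S) S * lam ^ 2 ≤ ‖H S‖ * ‖S‖ * lam ^ 2 := by gcongr
    _ = ‖H S‖ * lam * (lam * ‖S‖) := by ring
    _ ≤ ‖H S‖ * 1 * ‖H S‖ := by gcongr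
    _ = _ := by ring

/-- The exact gradient descent displacement has at most the energy of the minimizer. -/
theorem Coercive.energy_sum_le (h : Coercive H lam L) (hlam : 0 < lam) (hη : 0 < η)
    (hηL : η * L ≤ 1) (S : E) (K : ℕ) :
    energy H (η • ∑ k ∈ Finset.range K, linRes H η (H S) k) ≤ energy H S := by
  set T := η • ∑ k ∈ Finset.range K, linRes H η (H S) k with hT
  have h1 : H T = H S - linRes H η (H S) K := by
    rw [hT]
    clear hT
    induction K with
    | zero => simp [linRes]
    | succ K ih =>
      rw [Finset.sum_range_succ, smul_add, map_add, ih, linRes_succ, map_smul]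
      abel
  -- The sign of this term makes stopping at any finite `K` harmless: the leftover residual can only
  -- lower the energy.
  have h2 : (0 : ℝ) ≤ inner ℝ (linRes H η (H S) K) T := by
    rw [hT, real_inner_smul_right, inner_sum]
    exact mul_nonneg hη.le (Finset.sum_nonneg fun k _ => h.inner_linRes_nonneg hη hηL _ _ _)
  have h3 : energy H T ^ 2 ≤ energy H S * energy H T := by
    rw [h.energy_sq hlam]
    nth_rewrite 1 [h1]
    rw [inner_sub_left]
    linarith [h.inner_le_energy hlam S T]
  rcases (energy_nonneg (H := H) T).eq_or_lt with h0 | h0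
  · rw [← h0]; exact energy_nonneg _
  · rw [pow_two] at h3
    exact le_of_mul_le_mul_right h3 h0

/-- Sums of residuals of perturbed gradient descent. -/
theorem Coercive.norm_residual_sub_le {r : ℕ → E} {ε : ℝ} {K : ℕ} (hη : 0 < η) (hlam : 0 < lam)
    (hε : 0 ≤ ε) (hηlam : η * lam ≤ 1)
    (hdec : ∀ k < K, ‖r k‖ ≤ (1 - η * lam / 4) ^ k * ‖r 0‖)
    (hr : ∀ k < K, ‖r (k + 1) - (r k - η • H (r k))‖ ≤ η * ε * ‖r k‖) :
    ‖r 0 - r K - H (η • ∑ k ∈ Finset.range K, r k)‖ ≤ ε * (4 / lam * ‖r 0‖) := by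
  -- Telescoping: the deviation from the linear identity is the accumulated one-step defect.
  have h1 : r 0 - r K - H (η • ∑ k ∈ Finset.range K, r k) =
      -∑ k ∈ Finset.range K, (r (k + 1) - (r k - η • H (r k))) := by
    simp only [Finset.sum_sub_distrib, map_smul, map_sum, ← Finset.smul_sum]
    have := Finset.sum_range_sub r K
    rw [Finset.sum_sub_distrib] at this
    rw [← sub_add, this]
    abel
  rw [h1, norm_neg]
  calc _ ≤ ∑ k ∈ Finset.range K, η * ε * ‖r k‖ :=
        norm_sum_le_of_le _ fun k hk => hr k (Finset.mem_range.1 hk)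
    _ = ε * (η * ∑ k ∈ Finset.range K, ‖r k‖) := by rw [← Finset.mul_sum]; ring
    _ ≤ _ := mul_le_mul_of_nonneg_left (eta_mul_sum_norm_le hlam hη hηlam hdec) hε

/-- The distance `D k` to the exact iterates contracts and is forced by the defect. Rearranged as
`(ηλ/2) D k ≤ D k - D (k+1) + forcing`, the recursion telescopes from `D 0 = 0`, so the bound does
not grow with `K`. -/
theorem Coercive.norm_sum_sub_linRes_le (h : Coercive H lam L) {r : ℕ → E} {ε : ℝ} {K : ℕ}
    (hη : 0 < η) (hlam : 0 < lam) (hηL : η * L ^ 2 ≤ lam)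
    (hε : 0 ≤ ε) (hηlam : η * lam ≤ 1)
    (hdec : ∀ k < K, ‖r k‖ ≤ (1 - η * lam / 4) ^ k * ‖r 0‖)
    (hr : ∀ k < K, ‖r (k + 1) - (r k - η • H (r k))‖ ≤ η * ε * ‖r k‖) :
    ‖(η • ∑ k ∈ Finset.range K, r k) - η • ∑ k ∈ Finset.range K, linRes H η (r 0) k‖ ≤
      2 / lam * (ε * (4 / lam * ‖r 0‖)) := by
  set D : ℕ → ℝ := fun k => ‖r k - linRes H η (r 0) k‖ with hD
  have hstep : ∀ k < K, η * lam / 2 * D k ≤ D k - D (k + 1) + η * ε * ‖r k‖ := by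
    intro k hk
    have h1 : r (k + 1) - linRes H η (r 0) (k + 1) =
        (r (k + 1) - (r k - η • H (r k))) +
          ((r k - linRes H η (r 0) k) - η • H (r k - linRes H η (r 0) k)) := by
      rw [linRes_succ, map_sub, smul_sub]; abel
    have h2 := h.contract hη hηL hηlam (r k - linRes H η (r 0) k)
    have h3 : D (k + 1) ≤ η * ε * ‖r k‖ + (1 - η * lam / 2) * D k := by
      simp only [hD]
      rw [h1]
      exact (norm_add_le _ _).trans (add_le_add (hr k hk) h2)
    linarith
  have hsum : η * lam / 2 * ∑ k ∈ Finset.range K, D k ≤ ε * (4 / lam * ‖r 0‖) := by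
    have h1 : ∑ k ∈ Finset.range K, η * lam / 2 * D k ≤
        ∑ k ∈ Finset.range K, (D k - D (k + 1) + η * ε * ‖r k‖) :=
      Finset.sum_le_sum fun k hk => hstep k (Finset.mem_range.1 hk)
    rw [← Finset.mul_sum, Finset.sum_add_distrib, Finset.sum_range_sub', ← Finset.mul_sum] at h1
    have h0 : D 0 = 0 := by simp [hD, linRes]
    have hK : 0 ≤ D K := norm_nonneg _
    have := mul_le_mul_of_nonneg_left (eta_mul_sum_norm_le hlam hη hηlam hdec) hε
    linarith
  rw [← smul_sub, ← Finset.sum_sub_distrib, norm_smul, Real.norm_of_nonneg hη.le]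
  calc η * ‖∑ k ∈ Finset.range K, (r k - linRes H η (r 0) k)‖
      ≤ η * ∑ k ∈ Finset.range K, D k := by gcongr; exact norm_sum_le _ _
    _ = 2 / lam * (η * lam / 2 * ∑ k ∈ Finset.range K, D k) := by field_simp
    _ ≤ _ := by gcongr

end Abstract

/-! ### The network near a reference point: features, linearization, one training stage. -/

section Network

variable {d m n : ℕ}

/-- Weight matrices with the Frobenius inner product. -/
abbrev FrobSpace (d m : ℕ) : Type := PiLp 2 fun _ : Fin m => Input d

theorem frobNorm_eq (W : Weights d m) : frobNorm W = ‖(WithLp.toLp 2 W : FrobSpace d m)‖ := by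
  rw [PiLp.norm_eq_of_L2]; rfl

/-- The activation pattern `𝕀{wᵀ x ≥ 0}`. -/
def act (w x : Input d) : ℝ := if 0 ≤ (inner ℝ w x : ℝ) then 1 else 0

/-- The gradient of the network output with respect to the weights. -/
def feat (a : Fin m → ℝ) (W : Weights d m) (x : Input d) : FrobSpace d m :=
  WithLp.toLp 2 fun r => (1 / √(m : ℝ) * a r * act (W r) x) • x

/-- The fraction of hidden units whose preactivation at `x` is at most `R` in absolute value. -/
def nearFrac (W : Weights d m) (R : ℝ) (x : Input d) : ℝ :=
  (∑ r, if |(inner ℝ (W r) x : ℝ)| ≤ R then (1 : ℝ) else 0) / m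

/-- The vector of residuals `f(x_i) - y_i`. -/
def residual (a : Fin m → ℝ) (x : Fin n → Input d) (y : Fin n → ℝ) (W : Weights d m) :
    EuclideanSpace ℝ (Fin n) :=
  WithLp.toLp 2 fun i => network a W (x i) - y i

/-- Linear combination of the features of the inputs. -/
def featSum (a : Fin m → ℝ) (W : Weights d m) (x : Fin n → Input d)
    (v : EuclideanSpace ℝ (Fin n)) : FrobSpace d m :=
  ∑ j, v j • feat a W (x j)

/-- The adjoint of `featSum`. -/
def featAdj (a : Fin m → ℝ) (W : Weights d m) (x : Fin n → Input d)
    (w : FrobSpace d m) : EuclideanSpace ℝ (Fin n) :=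
  WithLp.toLp 2 fun i => inner ℝ (feat a W (x i)) w

theorem abs_coord_le (v : EuclideanSpace ℝ (Fin n)) (i : Fin n) : |v i| ≤ ‖v‖ := by
  simpa using PiLp.norm_apply_le v i

theorem sum_abs_le (v : EuclideanSpace ℝ (Fin n)) : ∑ i, |v i| ≤ n * ‖v‖ :=
  (Finset.sum_le_card_nsmul _ _ _ fun i _ => abs_coord_le v i).trans (by simp)

theorem norm_le_of_abs_le (v : EuclideanSpace ℝ (Fin n)) {c : ℝ}
    (h : ∀ i, |v i| ≤ c) : ‖v‖ ≤ n * c := by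
  have h1 : ‖v‖ ≤ ∑ i, |v i| := by
    rw [EuclideanSpace.norm_eq]
    refine Real.sqrt_le_iff.2 ⟨Finset.sum_nonneg fun _ _ => abs_nonneg _, ?_⟩
    exact Finset.sum_sq_le_sq_sum_of_nonneg fun _ _ => norm_nonneg _
  refine h1.trans ((Finset.sum_le_card_nsmul _ _ _ fun i _ => h i).trans (by simp))

theorem norm_sum_smul_le {V : Type*} [NormedAddCommGroup V] [NormedSpace ℝ V]
    (v : EuclideanSpace ℝ (Fin n)) (f : Fin n → V) {c : ℝ} (hc : 0 ≤ c) (h : ∀ i, ‖f i‖ ≤ c) :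
    ‖∑ i, v i • f i‖ ≤ n * c * ‖v‖ := by
  calc ‖∑ i, v i • f i‖ ≤ ∑ i, |v i| * c := by
        refine norm_sum_le_of_le _ fun i _ => ?_
        rw [norm_smul, Real.norm_eq_abs]
        gcongr
        exact h i
    _ ≤ n * ‖v‖ * c := by rw [← Finset.sum_mul]; gcongr; exact sum_abs_le v
    _ = _ := by ring

theorem relu_eq (w x : Input d) : relu (inner ℝ w x) = act w x * inner ℝ w x := by
  unfold relu act
  split_ifs with h
  · simp [h]
  · simp [(not_le.1 h).le]

theorem inner_feat (a : Fin m → ℝ) (W : Weights d m) (x : Input d) (w : FrobSpace d m) :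
    inner ℝ (feat a W x) w = ∑ r, 1 / √(m : ℝ) * a r * act (W r) x * inner ℝ (w r) x := by
  rw [PiLp.inner_apply]
  refine Finset.sum_congr rfl fun r _ => ?_
  rw [feat, real_inner_smul_left, real_inner_comm]

theorem abs_inner_sub_le {w w₀ x : Input d} {R : ℝ} (hx : ‖x‖ = 1) (h : ‖w - w₀‖ ≤ R) :
    |(inner ℝ w x : ℝ) - inner ℝ w₀ x| ≤ R := by
  rw [← inner_sub_left]
  exact (abs_real_inner_le_norm _ _).trans (by rw [hx, mul_one]; exact h)

theorem act_eq_of_lt {w w₀ x : Input d} {R : ℝ} (hx : ‖x‖ = 1) (h : ‖w - w₀‖ ≤ R)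
    (hR : R < |(inner ℝ w₀ x : ℝ)|) : act w x = act w₀ x := by
  have h1 := abs_le.1 (abs_inner_sub_le hx h)
  have : 0 ≤ (inner ℝ w x : ℝ) ↔ 0 ≤ (inner ℝ w₀ x : ℝ) := by
    rcases lt_abs.1 hR with h2 | h2
    · have := (norm_nonneg _).trans h
      constructor <;> intro <;> linarith
    · have := (norm_nonneg _).trans h
      constructor <;> intro <;> linarith
  simp [act, this]

theorem abs_act_sub_le (w w₀ x : Input d) : |act w x - act w₀ x| ≤ 1 := by
  unfold act; split_ifs <;> simp

theorem act_sq_le (w x : Input d) : act w x ^ 2 ≤ 1 := by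
  unfold act; split_ifs <;> simp

theorem nearFrac_nonneg (W : Weights d m) (R : ℝ) (x : Input d) : 0 ≤ nearFrac W R x :=
  div_nonneg (Finset.sum_nonneg fun r _ => by split_ifs <;> simp) (Nat.cast_nonneg m)

variable {a : Fin m → ℝ} {W W' W₀ : Weights d m}

/-- Only a unit within `R` of its kink at `W₀` can switch, and each switch costs `1/m`. It is the
square that is controlled, so features drift by the root of `nearFrac`. -/
theorem norm_feat_sub_sq_le (ha : ∀ r, |a r| = 1) {x : Input d} (hx : ‖x‖ = 1) {R : ℝ}
    (h : ∀ r, ‖W r - W₀ r‖ ≤ R) :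
    ‖feat a W x - feat a W₀ x‖ ^ 2 ≤ nearFrac W₀ R x := by
  rw [PiLp.norm_sq_eq_of_L2, nearFrac, Finset.sum_div]
  refine Finset.sum_le_sum fun r _ => ?_
  have h1 : (feat a W x - feat a W₀ x) r =
      (1 / √(m : ℝ) * a r * (act (W r) x - act (W₀ r) x)) • x := by
    simp only [feat, PiLp.sub_apply, ← sub_smul]
    congr 1; ring
  rw [h1, norm_smul, hx, mul_one, Real.norm_eq_abs, sq_abs, mul_pow, mul_pow, div_pow,
    Real.sq_sqrt (Nat.cast_nonneg m), ← sq_abs (a r), ha r]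
  split_ifs with h2
  · have := (sq_le_one_iff_abs_le_one _).2 (abs_act_sub_le (W r) (W₀ r) x)
    calc _ ≤ 1 ^ 2 / (m : ℝ) * 1 ^ 2 * 1 := by gcongr
      _ = _ := by ring
  · rw [act_eq_of_lt hx (h r) (not_le.1 h2)]
    simp

theorem norm_feat_le (hm : 0 < m) (ha : ∀ r, |a r| = 1) {x : Input d} (hx : ‖x‖ = 1) :
    ‖feat a W x‖ ≤ 1 := by
  refine (sq_le_one_iff₀ (norm_nonneg _)).1 ?_
  rw [PiLp.norm_sq_eq_of_L2]
  calc ∑ r, ‖feat a W x r‖ ^ 2 ≤ ∑ _r : Fin m, 1 / (m : ℝ) := by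
        refine Finset.sum_le_sum fun r _ => ?_
        simp only [feat]
        rw [norm_smul, hx, mul_one, Real.norm_eq_abs, sq_abs, mul_pow, mul_pow, div_pow,
          Real.sq_sqrt (Nat.cast_nonneg m), ← sq_abs (a r), ha r]
        calc _ ≤ 1 ^ 2 / (m : ℝ) * 1 ^ 2 * 1 := by gcongr; exact act_sq_le _ _
          _ = _ := by ring
    _ = 1 := by
        have : (m : ℝ) ≠ 0 := by positivity
        simp [this]

/-- The network is nearly linear in the weights close to `W₀`. -/
theorem abs_network_sub_sub_le (ha : ∀ r, |a r| = 1) {x : Input d} (hx : ‖x‖ = 1) {R M : ℝ}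
    (h : ∀ r, ‖W r - W₀ r‖ ≤ R) (h' : ∀ r, ‖W' r - W₀ r‖ ≤ R) (hM : ∀ r, ‖W' r - W r‖ ≤ M) :
    |network a W' x - network a W x -
      inner ℝ (feat a W₀ x) (WithLp.toLp 2 (W' - W) : FrobSpace d m)| ≤
      √(m : ℝ) * nearFrac W₀ R x * M := by
  have h1 : network a W' x - network a W x -
      inner ℝ (feat a W₀ x) (WithLp.toLp 2 (W' - W) : FrobSpace d m) =
      ∑ r, 1 / √(m : ℝ) * a r * (relu (inner ℝ (W' r) x) - relu (inner ℝ (W r) x) -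
        act (W₀ r) x * (inner ℝ (W' r) x - inner ℝ (W r) x)) := by
    rw [inner_feat, network, network, Finset.mul_sum, Finset.mul_sum, ← Finset.sum_sub_distrib,
      ← Finset.sum_sub_distrib]
    refine Finset.sum_congr rfl fun r _ => ?_
    rw [show (WithLp.toLp 2 (W' - W) : FrobSpace d m) r = W' r - W r from rfl, inner_sub_left]
    ring
  rw [h1]
  have h2 : √(m : ℝ) * nearFrac W₀ R x * M =
      ∑ r, 1 / √(m : ℝ) * ((if |(inner ℝ (W₀ r) x : ℝ)| ≤ R then (1 : ℝ) else 0) * M) := by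
    rw [nearFrac, ← Finset.mul_sum, ← Finset.sum_mul]
    rcases Nat.eq_zero_or_pos m with rfl | hm
    · simp
    · have h3 : √(m : ℝ) * √(m : ℝ) = m := Real.mul_self_sqrt (Nat.cast_nonneg m)
      have h4 : 0 < √(m : ℝ) := by positivity
      nth_rewrite 2 [← h3]
      field_simp
  rw [h2]
  refine (Finset.abs_sum_le_sum_abs _ _).trans (Finset.sum_le_sum fun r _ => ?_)
  rw [abs_mul, abs_mul, ha r, mul_one, abs_of_nonneg (by positivity : 0 ≤ 1 / √(m : ℝ))]
  gcongr
  -- Near the kink, `relu z' - relu z - s (z' - z)` with `s ∈ {0, 1}` is at most `|z' - z|`; away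
  -- from it the activation is frozen and the term vanishes.
  split_ifs with h3
  · have h4 : |(inner ℝ (W' r) x : ℝ) - inner ℝ (W r) x| ≤ M := abs_inner_sub_le hx (hM r)
    refine le_trans ?_ (h4.trans (one_mul M).ge)
    unfold relu act
    generalize (inner ℝ (W' r) x : ℝ) = z'
    generalize (inner ℝ (W r) x : ℝ) = z
    split_ifs <;> rcases max_cases z 0 with ⟨e, _⟩ | ⟨e, _⟩ <;>
      rcases max_cases z' 0 with ⟨e', _⟩ | ⟨e', _⟩ <;> rw [e, e', abs_le] <;>
      rcases abs_cases (z' - z) with ⟨e'', _⟩ | ⟨e'', _⟩ <;> rw [e''] <;>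
      constructor <;> linarith
  · rw [relu_eq, relu_eq, act_eq_of_lt hx (h r) (not_le.1 h3),
      act_eq_of_lt hx (h' r) (not_le.1 h3)]
    simp [mul_sub]

variable {x : Fin n → Input d} {y : Fin n → ℝ} {η : ℝ}

theorem toLp_lossGrad :
    (WithLp.toLp 2 (lossGrad a x y W) : FrobSpace d m) = featSum a W x (residual a x y W) := by
  ext1 r
  simp only [featSum, lossGrad, feat, residual, WithLp.ofLp_sum, Finset.sum_apply,
    WithLp.ofLp_smul, Pi.smul_apply, Finset.smul_sum, smul_smul, act]
  refine Finset.sum_congr rfl fun i _ => ?_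
  congr 1; ring

/-- The factor `1/√m` on each unit is the source of lazy training: single units barely move,
although the whole matrix may move by a distance of order one. -/
theorem norm_lossGrad_le (ha : ∀ r, |a r| = 1) (hx : ∀ i, ‖x i‖ = 1) (r : Fin m) :
    ‖lossGrad a x y W r‖ ≤ n / √(m : ℝ) * ‖residual a x y W‖ := by
  rw [lossGrad, norm_smul, Real.norm_of_nonneg (by positivity)]
  have h1 : ‖∑ i, ((network a W (x i) - y i) * a r *
      (if 0 ≤ (inner ℝ (W r) (x i) : ℝ) then 1 else 0)) • x i‖ ≤ n * 1 * ‖residual a x y W‖ := by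
    have := norm_sum_smul_le (residual a x y W)
      (fun i => (a r * (if 0 ≤ (inner ℝ (W r) (x i) : ℝ) then (1 : ℝ) else 0)) • x i)
      zero_le_one (fun i => by
        rw [norm_smul, hx, mul_one, norm_mul, Real.norm_eq_abs, ha, one_mul]
        split_ifs <;> simp)
    simpa only [residual, smul_smul, mul_assoc] using this
  calc _ ≤ 1 / √(m : ℝ) * (n * 1 * ‖residual a x y W‖) := by gcongr
    _ = _ := by ring

theorem gradDescent_succ (k : ℕ) : gradDescent a x y η W (k + 1) =
    gradDescent a x y η W k - η • lossGrad a x y (gradDescent a x y η W k) := by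
  simp [gradDescent, Function.iterate_succ_apply']

theorem norm_gradDescent_sub_le (ha : ∀ r, |a r| = 1) (hx : ∀ i, ‖x i‖ = 1) (hη : 0 < η)
    (K : ℕ) (r : Fin m) :
    ‖gradDescent a x y η W K r - W r‖ ≤
      n / √(m : ℝ) * (η * ∑ k ∈ Finset.range K, ‖residual a x y (gradDescent a x y η W k)‖) := by
  induction K with
  | zero => simp [gradDescent]
  | succ K ih =>
    rw [gradDescent_succ, Finset.sum_range_succ]
    have h1 : (gradDescent a x y η W K - η • lossGrad a x y (gradDescent a x y η W K)) r - W r =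
      (gradDescent a x y η W K r - W r) - η • lossGrad a x y (gradDescent a x y η W K) r := by
      simp only [Pi.sub_apply, Pi.smul_apply]; abel
    rw [h1]
    refine (norm_sub_le _ _).trans ?_
    rw [norm_smul, Real.norm_of_nonneg hη.le]
    have := mul_le_mul_of_nonneg_left
      (norm_lossGrad_le (W := gradDescent a x y η W K) (y := y) ha hx r) hη.le
    linarith

theorem featSum_sub (v w : EuclideanSpace ℝ (Fin n)) :
    featSum a W x (v - w) = featSum a W x v - featSum a W x w := by
  simp [featSum, sub_smul, Finset.sum_sub_distrib]

theorem norm_featSum_le (hm : 0 < m) (ha : ∀ r, |a r| = 1) (hx : ∀ i, ‖x i‖ = 1)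
    (v : EuclideanSpace ℝ (Fin n)) : ‖featSum a W x v‖ ≤ n * ‖v‖ := by
  have := norm_sum_smul_le v (fun i => feat a W (x i)) zero_le_one
    fun i => norm_feat_le hm ha (hx i)
  rwa [mul_one] at this

theorem norm_featSum_sub_le (ha : ∀ r, |a r| = 1) (hx : ∀ i, ‖x i‖ = 1) {R τ : ℝ} (hτ : 0 ≤ τ)
    (h : ∀ r, ‖W r - W₀ r‖ ≤ R) (hs : ∀ i, nearFrac W₀ R (x i) ≤ τ ^ 2)
    (v : EuclideanSpace ℝ (Fin n)) :
    ‖featSum a W x v - featSum a W₀ x v‖ ≤ n * τ * ‖v‖ := by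
  rw [featSum, featSum, ← Finset.sum_sub_distrib]
  simp only [← smul_sub]
  refine norm_sum_smul_le v _ hτ fun i => ?_
  exact abs_le_of_sq_le_sq' ((norm_feat_sub_sq_le ha (hx i) h).trans (hs i)) hτ |>.2

theorem norm_featAdj_le (hm : 0 < m) (ha : ∀ r, |a r| = 1) (hx : ∀ i, ‖x i‖ = 1)
    (w : FrobSpace d m) : ‖featAdj a W x w‖ ≤ n * ‖w‖ := by
  refine norm_le_of_abs_le _ fun i => ?_
  refine (abs_real_inner_le_norm _ _).trans ?_
  have := norm_feat_le (W := W) hm ha (hx i)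
  nlinarith [norm_nonneg w]

theorem inner_featSum_self (v : EuclideanSpace ℝ (Fin n)) :
    ‖featSum a W x v‖ ^ 2 = inner ℝ (featAdj a W x (featSum a W x v)) v := by
  have h : ∀ w, (inner ℝ (featSum a W x v) w : ℝ) = ∑ j, v j * inner ℝ (feat a W (x j)) w := by
    intro w
    simp only [featSum, sum_inner, real_inner_smul_left]
  rw [← real_inner_self_eq_norm_sq, h, PiLp.inner_apply]
  simp [featAdj]

/-- One step of gradient descent near `W₀`, compared with the linear dynamics. -/
theorem norm_residual_step_le {H : EuclideanSpace ℝ (Fin n) →L[ℝ] EuclideanSpace ℝ (Fin n)}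
    (hm : 0 < m) (hn : 0 < n) (ha : ∀ r, |a r| = 1) (hx : ∀ i, ‖x i‖ = 1) (hη : 0 < η)
    {R τ : ℝ} (hτ : 0 ≤ τ) (hτ1 : τ ≤ 1)
    (hs : ∀ i, nearFrac W₀ R (x i) ≤ τ ^ 2)
    (hG : ∀ v, ‖H v - featAdj a W₀ x (featSum a W₀ x v)‖ ≤ τ ^ 2 * ‖v‖)
    (hW' : W' = W - η • lossGrad a x y W)
    (h : ∀ r, ‖W r - W₀ r‖ ≤ R) (h' : ∀ r, ‖W' r - W₀ r‖ ≤ R) :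
    ‖residual a x y W' - (residual a x y W - η • H (residual a x y W))‖ ≤
      η * (3 * n ^ 2 * τ) * ‖residual a x y W‖ := by
  set v := residual a x y W with hv
  have hn1 : (1 : ℝ) ≤ n := by exact_mod_cast hn
  have hd : (WithLp.toLp 2 (W' - W) : FrobSpace d m) = -(η • featSum a W x v) := by
    rw [hv, ← toLp_lossGrad, hW']
    simp [← WithLp.toLp_smul, ← WithLp.toLp_neg]
  have hM : ∀ r, ‖W' r - W r‖ ≤ η * (n / √(m : ℝ) * ‖v‖) := by
    intro r
    have : W' r - W r = -(η • lossGrad a x y W r) := by rw [hW']; simp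
    rw [this, norm_neg, norm_smul, Real.norm_of_nonneg hη.le]
    gcongr
    exact norm_lossGrad_le ha hx r
  set e : EuclideanSpace ℝ (Fin n) := WithLp.toLp 2 fun i =>
    network a W' (x i) - network a W (x i) -
      inner ℝ (feat a W₀ (x i)) (WithLp.toLp 2 (W' - W) : FrobSpace d m) with he
  -- Three errors: nonlinearity along the step, `H` against the Gram matrix at `W₀`, and features at
  -- `W` against those at `W₀`. The first two are of order `τ ^ 2`, the last only of order `τ`.
  have hsplit : residual a x y W' - (v - η • H v) = e +
      (η • (H v - featAdj a W₀ x (featSum a W₀ x v)) -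
        η • featAdj a W₀ x (featSum a W x v - featSum a W₀ x v)) := by
    ext i
    simp only [he, hd, hv, residual, featAdj, PiLp.sub_apply, PiLp.add_apply, PiLp.smul_apply,
      smul_eq_mul, inner_neg_right, real_inner_smul_right, inner_sub_right]
    ring
  have he1 : ‖e‖ ≤ n * (n * τ ^ 2 * (η * ‖v‖)) := by
    refine norm_le_of_abs_le _ fun i => ?_
    refine (abs_network_sub_sub_le ha (hx i) h h' hM).trans ?_
    have h4 : 0 < √(m : ℝ) := by positivity
    calc √(m : ℝ) * nearFrac W₀ R (x i) * (η * (n / √(m : ℝ) * ‖v‖))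
        = n * nearFrac W₀ R (x i) * (η * ‖v‖) := by field_simp
      _ ≤ _ := by gcongr; exact hs i
  have he2 : ‖featAdj a W₀ x (featSum a W x v - featSum a W₀ x v)‖ ≤ n * (n * τ * ‖v‖) := by
    refine (norm_featAdj_le hm ha hx _).trans ?_
    gcongr
    exact norm_featSum_sub_le ha hx hτ h hs v
  rw [hsplit]
  refine (norm_add_le _ _).trans ((add_le_add le_rfl (norm_sub_le _ _)).trans ?_)
  rw [norm_smul, norm_smul, Real.norm_of_nonneg hη.le]
  have hτ2 : τ ^ 2 ≤ τ := by nlinarith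
  have hn2 : (1 : ℝ) ≤ n ^ 2 := one_le_pow₀ hn1
  calc ‖e‖ + (η * ‖H v - featAdj a W₀ x (featSum a W₀ x v)‖ +
        η * ‖featAdj a W₀ x (featSum a W x v - featSum a W₀ x v)‖)
      ≤ n * (n * τ ^ 2 * (η * ‖v‖)) + (η * (τ ^ 2 * ‖v‖) + η * (n * (n * τ * ‖v‖))) := by
        gcongr; exact hG v
    _ ≤ n * (n * τ * (η * ‖v‖)) + (η * (n ^ 2 * τ * ‖v‖) + η * (n * (n * τ * ‖v‖))) := by
        gcongr
        calc τ ^ 2 ≤ 1 * τ := by linarith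
          _ ≤ n ^ 2 * τ := by gcongr
    _ = _ := by ring

/-- Gradient descent on one data set, started near the reference weights `W₀`. -/
theorem gradDescent_stage {H : EuclideanSpace ℝ (Fin n) →L[ℝ] EuclideanSpace ℝ (Fin n)}
    {lam L : ℝ} (hH : Coercive H lam L)
    (hm : 0 < m) (hn : 0 < n) (ha : ∀ r, |a r| = 1) (hx : ∀ i, ‖x i‖ = 1) (hη : 0 < η)
    (hlam : 0 < lam) (hηL : η * L ^ 2 ≤ lam) (hηlam : η * lam ≤ 1)
    {R R₁ τ : ℝ} (hτ : 0 ≤ τ) (hτ1 : 3 * n ^ 2 * τ ≤ lam / 4) (hlam1 : lam ≤ 1)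
    (hs : ∀ i, nearFrac W₀ R (x i) ≤ τ ^ 2)
    (hG : ∀ v, ‖H v - featAdj a W₀ x (featSum a W₀ x v)‖ ≤ τ ^ 2 * ‖v‖)
    (h : ∀ r, ‖W r - W₀ r‖ ≤ R₁)
    (hR : R₁ + n / √(m : ℝ) * (4 / lam * ‖residual a x y W‖) ≤ R) (K : ℕ) :
    let r : ℕ → EuclideanSpace ℝ (Fin n) := fun k => residual a x y (gradDescent a x y η W k)
    let T : EuclideanSpace ℝ (Fin n) := η • ∑ k ∈ Finset.range K, r k
    (∀ s, ‖gradDescent a x y η W K s - W s‖ ≤ n / √(m : ℝ) * (4 / lam * ‖r 0‖)) ∧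
    ‖r K‖ ≤ (1 - η * lam / 4) ^ K * ‖r 0‖ ∧
    ‖WithLp.toLp 2 (gradDescent a x y η W K - W) + featSum a W₀ x T‖ ≤
      n * τ * (4 / lam * ‖r 0‖) ∧
    ‖r 0 - r K - H T‖ ≤ 3 * n ^ 2 * τ * (4 / lam * ‖r 0‖) ∧
    ‖T - η • ∑ k ∈ Finset.range K, linRes H η (r 0) k‖ ≤
      2 / lam * (3 * n ^ 2 * τ * (4 / lam * ‖r 0‖)) ∧
    ‖T‖ ≤ 4 / lam * ‖r 0‖ := by
  intro r T
  have hn1 : (1 : ℝ) ≤ n := by exact_mod_cast hn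
  have hτ2 : τ ≤ 1 := by nlinarith [one_le_pow₀ hn1 (n := 2)]
  have hr0 : r 0 = residual a x y W := rfl
  have hnear_of : ∀ K, (∀ k < K, ‖r k‖ ≤ (1 - η * lam / 4) ^ k * ‖r 0‖) →
      ∀ s, ‖gradDescent a x y η W K s - W s‖ ≤ n / √(m : ℝ) * (4 / lam * ‖r 0‖) := by
    intro K hK s
    refine (norm_gradDescent_sub_le ha hx hη K s).trans ?_
    exact mul_le_mul_of_nonneg_left (eta_mul_sum_norm_le hlam hη hηlam hK) (by positivity)
  have hnear' : ∀ K, (∀ k < K, ‖r k‖ ≤ (1 - η * lam / 4) ^ k * ‖r 0‖) →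
      ∀ s, ‖gradDescent a x y η W K s - W₀ s‖ ≤ R := by
    intro K hK s
    rw [← sub_add_sub_cancel _ (W s) (W₀ s)]
    refine (norm_add_le _ _).trans (le_trans ?_ hR)
    rw [add_comm]
    exact add_le_add (h s) (hnear_of K hK s)
  -- Both ends of the step must lie in the ball of radius `R`; the position after step `K` involves
  -- the residuals up to index `K`, hence decay for all `k < K + 1`.
  have hstep : ∀ K, (∀ k < K + 1, ‖r k‖ ≤ (1 - η * lam / 4) ^ k * ‖r 0‖) →
      ‖r (K + 1) - (r K - η • H (r K))‖ ≤ η * (3 * n ^ 2 * τ) * ‖r K‖ := by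
    intro K hK
    exact norm_residual_step_le hm hn ha hx hη hτ hτ2 hs hG (gradDescent_succ K)
      (hnear' K fun k hk => hK k (by omega)) (hnear' (K + 1) hK)
  -- Bootstrap: past decay keeps the weights in the ball, where the dynamics is almost linear, and
  -- this gives decay at the next step. Half of the linear rate `ηλ/2` is given up to the
  -- perturbation.
  have hdec : ∀ k, ‖r k‖ ≤ (1 - η * lam / 4) ^ k * ‖r 0‖ := by
    intro k
    induction k using Nat.strong_induction_on with
    | _ k ih =>
      rcases k with _ | k
      · simp
      · have h1 := hstep k ih
        have h2 := hH.contract hη hηL hηlam (r k)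
        have h3 : ‖r (k + 1)‖ ≤ (1 - η * lam / 4) * ‖r k‖ := by
          rw [← sub_add_cancel (r (k + 1)) (r k - η • H (r k))]
          refine (norm_add_le _ _).trans ((add_le_add h1 h2).trans ?_)
          have : η * (3 * n ^ 2 * τ) ≤ η * (lam / 4) := by gcongr
          nlinarith [norm_nonneg (r k)]
        refine h3.trans ?_
        rw [pow_succ', mul_assoc]
        exact mul_le_mul_of_nonneg_left (ih k (by omega)) (by linarith)
  have hε : 0 ≤ 3 * (n : ℝ) ^ 2 * τ := by positivity
  have hstep' : ∀ k < K, ‖r (k + 1) - (r k - η • H (r k))‖ ≤ η * (3 * n ^ 2 * τ) * ‖r k‖ :=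
    fun k _ => hstep k fun k _ => hdec k
  have hsum := eta_mul_sum_norm_le (K := K) hlam hη hηlam fun k _ => hdec k
  refine ⟨hnear_of K fun k _ => hdec k, hdec K, ?_,
    Coercive.norm_residual_sub_le hη hlam hε hηlam (fun k _ => hdec k) hstep',
    hH.norm_sum_sub_linRes_le hη hlam hηL hε hηlam (fun k _ => hdec k) hstep', ?_⟩
  · have h1 : (WithLp.toLp 2 (gradDescent a x y η W K - W) : FrobSpace d m) +
        featSum a W₀ x T = -(η • ∑ k ∈ Finset.range K,
          (featSum a (gradDescent a x y η W k) x (r k) - featSum a W₀ x (r k))) := by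
      have h2 : featSum a W₀ x T = η • ∑ k ∈ Finset.range K, featSum a W₀ x (r k) := by
        simp only [T, featSum, PiLp.smul_apply, WithLp.ofLp_sum, Finset.sum_apply, smul_eq_mul,
          mul_smul, Finset.sum_smul, ← Finset.smul_sum]
        rw [Finset.sum_comm]
      have h3 : (WithLp.toLp 2 (gradDescent a x y η W K - W) : FrobSpace d m) =
          -(η • ∑ k ∈ Finset.range K, featSum a (gradDescent a x y η W k) x (r k)) := by
        clear h2 hsum hstep'
        clear T
        induction K with
        | zero => simp [gradDescent]
        | succ K ih =>
          rw [Finset.sum_range_succ, smul_add, neg_add, ← ih, gradDescent_succ, ← toLp_lossGrad,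
            ← WithLp.toLp_smul, ← WithLp.toLp_neg, ← WithLp.toLp_add]
          congr 1; abel
      rw [h2, h3, Finset.sum_sub_distrib, smul_sub]
      abel
    rw [h1, norm_neg, norm_smul, Real.norm_of_nonneg hη.le]
    calc _ ≤ η * ∑ k ∈ Finset.range K, n * τ * ‖r k‖ := by
          gcongr
          refine norm_sum_le_of_le _ fun k _ => ?_
          exact norm_featSum_sub_le ha hx hτ (hnear' k fun k _ => hdec k) hs _
      _ = n * τ * (η * ∑ k ∈ Finset.range K, ‖r k‖) := by rw [← Finset.mul_sum]; ring
      _ ≤ _ := mul_le_mul_of_nonneg_left hsum (by positivity)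
  · rw [norm_smul, Real.norm_of_nonneg hη.le]
    exact (mul_le_mul_of_nonneg_left (norm_sum_le _ _) hη.le).trans hsum

end Network

/-! ### The distance travelled on one data set, measured by the limiting kernel. -/

section Transfer

variable {d m n n' : ℕ}

theorem norm_mulVec_le (M : Matrix (Fin n') (Fin n) ℝ) (hM : ∀ i j, |M i j| ≤ 1)
    (v : EuclideanSpace ℝ (Fin n)) :
    ‖(WithLp.toLp 2 (M *ᵥ v) : EuclideanSpace ℝ (Fin n'))‖ ≤ √(n' : ℝ) * √(n : ℝ) * ‖v‖ := by
  refine abs_le_of_sq_le_sq' ?_ (by positivity) |>.2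
  rw [EuclideanSpace.real_norm_sq_eq, mul_pow, mul_pow, Real.sq_sqrt (Nat.cast_nonneg _),
    Real.sq_sqrt (Nat.cast_nonneg _), EuclideanSpace.real_norm_sq_eq]
  calc ∑ i, (M *ᵥ v) i ^ 2 ≤ ∑ _i : Fin n', (n : ℝ) * ∑ j, v j ^ 2 := by
        refine Finset.sum_le_sum fun i _ => ?_
        refine (Finset.sum_mul_sq_le_sq_mul_sq Finset.univ (M i) v).trans ?_
        gcongr
        calc ∑ j, M i j ^ 2 ≤ ∑ _j : Fin n, (1 : ℝ) :=
              Finset.sum_le_sum fun j _ => (sq_le_one_iff_abs_le_one _).2 (hM i j)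
          _ = n := by simp
    _ = _ := by simp [mul_assoc]

/-- Subtracting `lam` shifts the spectrum into the nonnegative reals, which gives positive
semidefiniteness; the upper constant `n` is the bound on the Frobenius norm from entries at most
one. -/
theorem coercive_toEuclideanCLM {M : Matrix (Fin n) (Fin n) ℝ} (hM : M.IsHermitian)
    (hM1 : ∀ i j, |M i j| ≤ 1) {lam : ℝ} (hlam : IsLeast (spectrum ℝ M) lam) :
    Coercive (toEuclideanCLM (𝕜 := ℝ) M) lam n where
  symm v w := by
    rw [← ContinuousLinearMap.adjoint_inner_right, ← ContinuousLinearMap.star_eq_adjoint,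
      ← map_star, star_eq_conjTranspose, hM.eq]
  lower v := by
    have h1 : (M - algebraMap ℝ _ lam).PosSemidef := by
      refine posSemidef_iff_isHermitian_and_spectrum_nonneg.2 ⟨hM.sub ?_, fun μ hμ => ?_⟩
      · rw [IsHermitian, algebraMap_eq_diagonal, diagonal_conjTranspose]; rfl
      · rw [← spectrum.sub_singleton_eq] at hμ
        obtain ⟨a, ha, b, hb, rfl⟩ := hμ
        rw [Set.mem_singleton_iff] at hb
        have := hlam.2 ha
        simp [hb, this]
    have h2 := h1.dotProduct_mulVec_nonneg v
    rw [sub_mulVec, dotProduct_sub, Algebra.algebraMap_eq_smul_one, smul_mulVec, one_mulVec,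
      dotProduct_smul, smul_eq_mul, star_trivial] at h2
    rw [real_inner_comm, inner_toEuclideanCLM, EuclideanSpace.real_norm_sq_eq]
    have h3 : (v : Fin n → ℝ) ⬝ᵥ v = ∑ i, v i ^ 2 := by simp [dotProduct, pow_two]
    rw [h3] at h2
    linarith
  upper v := by
    have := norm_mulVec_le M hM1 v
    rwa [Real.mul_self_sqrt (Nat.cast_nonneg _)] at this

variable {a : Fin m → ℝ} {W W₀ : Weights d m} {x : Fin n → Input d} {y : Fin n → ℝ} {η : ℝ}

theorem norm_sub_featAdj_le {x : Fin n → Input d} {M : Matrix (Fin n) (Fin n) ℝ} {γ : ℝ}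
    (h : ∀ i j, |inner ℝ (feat a W₀ (x i)) (feat a W₀ (x j)) - M i j| ≤ γ)
    (v : EuclideanSpace ℝ (Fin n)) :
    ‖toEuclideanCLM (𝕜 := ℝ) M v - featAdj a W₀ x (featSum a W₀ x v)‖ ≤ n ^ 2 * γ * ‖v‖ := by
  rw [pow_two, mul_assoc, mul_assoc]
  refine norm_le_of_abs_le _ fun i => ?_
  have h1 : (toEuclideanCLM (𝕜 := ℝ) M v - featAdj a W₀ x (featSum a W₀ x v)) i =
      -∑ j, v j * (inner ℝ (feat a W₀ (x i)) (feat a W₀ (x j)) - M i j) := by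
    simp only [PiLp.sub_apply, ofLp_toEuclideanCLM, mulVec, dotProduct, featAdj, featSum, inner_sum,
      real_inner_smul_right, mul_sub, Finset.sum_sub_distrib]
    simp only [mul_comm (v _)]
    ring
  rw [h1, abs_neg]
  calc _ ≤ ∑ j, |v j| * γ := by
        refine (Finset.abs_sum_le_sum_abs _ _).trans (Finset.sum_le_sum fun j _ => ?_)
        rw [abs_mul]
        gcongr
        exact h i j
    _ ≤ _ := by
        rw [← Finset.sum_mul, mul_comm γ, ← mul_assoc]
        rcases Nat.eq_zero_or_pos n with rfl | hn
        · simp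
        · have : 0 ≤ γ := (abs_nonneg _).trans (h ⟨0, hn⟩ ⟨0, hn⟩)
          gcongr
          exact sum_abs_le v

/-- The distance travelled by gradient descent is at most the energy of the minimizer of the
linearized problem, up to small errors. -/
theorem norm_gradDescent_sub_le_energy
    {H : EuclideanSpace ℝ (Fin n) →L[ℝ] EuclideanSpace ℝ (Fin n)}
    {lam L : ℝ} (hH : Coercive H lam L)
    (hm : 0 < m) (hn : 0 < n) (ha : ∀ r, |a r| = 1) (hx : ∀ i, ‖x i‖ = 1) (hη : 0 < η)
    (hlam : 0 < lam) (hηL : η * L ^ 2 ≤ lam) (hηL1 : η * L ≤ 1) (hηlam : η * lam ≤ 1)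
    {R R₁ τ B : ℝ} (hτ : 0 ≤ τ) (hτ1 : 3 * n ^ 2 * τ ≤ lam / 4) (hlam1 : lam ≤ 1)
    (hs : ∀ i, nearFrac W₀ R (x i) ≤ τ ^ 2)
    (hG : ∀ v, ‖H v - featAdj a W₀ x (featSum a W₀ x v)‖ ≤ τ ^ 2 * ‖v‖)
    (h : ∀ r, ‖W r - W₀ r‖ ≤ R₁)
    (hR : R₁ + n / √(m : ℝ) * (4 / lam * ‖residual a x y W‖) ≤ R)
    (hB : 4 / lam * ‖residual a x y W‖ = B)
    (S : EuclideanSpace ℝ (Fin n)) (hS : H S = residual a x y W) (K : ℕ) :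
    frobNorm (gradDescent a x y η W K - W) ≤ energy H S +
      (n * τ * B + n * (2 / lam * (3 * n ^ 2 * τ * B)) +
        τ * (B + 2 / lam * (3 * n ^ 2 * τ * B))) := by
  obtain ⟨-, -, h3, -, h5, h6⟩ := gradDescent_stage hH hm hn ha hx hη hlam hηL hηlam hτ hτ1 hlam1
    hs hG h hR K
  have hE := hH.energy_sum_le hlam hη hηL1 S K
  rw [hS] at hE
  set T : EuclideanSpace ℝ (Fin n) :=
    η • ∑ k ∈ Finset.range K, residual a x y (gradDescent a x y η W k)
  have hr0 : residual a x y (gradDescent a x y η W 0) = residual a x y W := rfl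
  simp only [hr0, hB] at h3 h5 h6
  set T' := η • ∑ k ∈ Finset.range K, linRes H η (residual a x y W) k
  have hT' : ‖T'‖ ≤ B + 2 / lam * (3 * n ^ 2 * τ * B) := by
    have : T' = T - (T - T') := by abel
    rw [this]
    exact (norm_sub_le _ _).trans (add_le_add h6 h5)
  -- The energy estimate is available for the exact sum `T'` only. Replacing the Gram matrix at `W₀`
  -- by `H` costs `τ ^ 2 * ‖T'‖ ^ 2` in the square, hence `τ * ‖T'‖` after the root.
  have h7 : ‖featSum a W₀ x T'‖ ≤ energy H S + τ * ‖T'‖ := by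
    refine abs_le_of_sq_le_sq' ?_ (add_nonneg (energy_nonneg _) (by positivity)) |>.2
    have h8 : ‖featSum a W₀ x T'‖ ^ 2 = inner ℝ (H T') T' -
        inner ℝ (H T' - featAdj a W₀ x (featSum a W₀ x T')) T' := by
      rw [inner_featSum_self, inner_sub_left]; ring
    have h9 : -(inner ℝ (H T' - featAdj a W₀ x (featSum a W₀ x T')) T' : ℝ) ≤
        τ ^ 2 * ‖T'‖ * ‖T'‖ := by
      refine (neg_le_abs _).trans ((abs_real_inner_le_norm _ _).trans ?_)
      gcongr
      exact hG T'
    have h10 : inner ℝ (H T') T' ≤ energy H S ^ 2 := by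
      rw [← hH.energy_sq hlam]
      exact pow_le_pow_left₀ (energy_nonneg _) hE 2
    have h11 : 0 ≤ energy H S * (τ * ‖T'‖) := mul_nonneg (energy_nonneg _) (by positivity)
    rw [h8]
    nlinarith
  have h12 : ‖featSum a W₀ x T‖ ≤ ‖featSum a W₀ x T'‖ + n * ‖T - T'‖ := by
    have : featSum a W₀ x T = featSum a W₀ x T' + featSum a W₀ x (T - T') := by
      rw [featSum_sub]; abel
    rw [this]
    exact (norm_add_le _ _).trans (add_le_add le_rfl (norm_featSum_le hm ha hx _))
  rw [frobNorm_eq]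
  have h13 : (WithLp.toLp 2 (gradDescent a x y η W K - W) : FrobSpace d m) =
      (WithLp.toLp 2 (gradDescent a x y η W K - W) + featSum a W₀ x T) - featSum a W₀ x T := by
    abel
  rw [h13]
  refine (norm_sub_le _ _).trans ?_
  have h14 : (n : ℝ) * ‖T - T'‖ ≤ n * (2 / lam * (3 * n ^ 2 * τ * B)) := by gcongr
  have h15 : τ * ‖T'‖ ≤ τ * (B + 2 / lam * (3 * n ^ 2 * τ * B)) := by gcongr
  linarith

end Transfer

/-! ### From source to target, on a well-behaved initialization. -/

section Transfer

variable {d m nP nQ : ℕ} {a : Fin m → ℝ} {W₀ : Weights d m}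
  {xP : Fin nP → Input d} {yP : Fin nP → ℝ} {xQ : Fin nQ → Input d} {yQ : Fin nQ → ℝ}

theorem energy_neg {E : Type*} [NormedAddCommGroup E] [InnerProductSpace ℝ E] (H : E →L[ℝ] E)
    (v : E) : energy H (-v) = energy H v := by
  simp [energy]

/-- Bookkeeping device: one number `X ≥ 10` dominates all parameters, and numerical constants are
absorbed by raising its exponent. -/
theorem ten_mul_pow_le {X : ℝ} (hX : 10 ≤ X) {i j : ℕ} (h : i < j) : 10 * X ^ i ≤ X ^ j := by
  calc 10 * X ^ i ≤ X * X ^ i := by gcongr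
    _ = X ^ (i + 1) := (pow_succ' X i).symm
    _ ≤ X ^ j := pow_le_pow_right₀ (by linarith) h

theorem three_mul_sq_mul_le {X τ lam n : ℝ} (hlam : 0 < lam) (hτ : 0 ≤ τ) (hX : 10 ≤ X)
    (hXτ : X ^ 5 * τ ≤ 1) (hXn : n ≤ X) (hn : 0 ≤ n) (hXlam : lam⁻¹ ≤ X) :
    3 * n ^ 2 * τ ≤ lam / 4 := by
  have hX0 : 0 < X := by linarith
  have h1 : 12 * X ^ 3 * τ ≤ 1 := by
    refine le_trans ?_ hXτ
    gcongr
    have := ten_mul_pow_le hX (show 3 < 4 by norm_num)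
    have := ten_mul_pow_le hX (show 4 < 5 by norm_num)
    linarith [pow_pos hX0 3]
  have h2 : 12 * X ^ 2 * τ ≤ lam := by
    have h3 : 1 ≤ lam * X := by
      rw [← mul_inv_cancel₀ hlam.ne']
      gcongr
    have h4 : 0 ≤ 12 * X ^ 2 * τ := by positivity
    calc 12 * X ^ 2 * τ ≤ (lam * X) * (12 * X ^ 2 * τ) := le_mul_of_one_le_left h4 h3
      _ = lam * (12 * X ^ 3 * τ) := by ring
      _ ≤ _ := mul_le_of_le_one_right hlam.le h1
  have h5 : n ^ 2 * τ ≤ X ^ 2 * τ := by gcongr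
  linarith

theorem mul_inv_toEuclideanCLM {n : ℕ} {M : Matrix (Fin n) (Fin n) ℝ} (h : M * M⁻¹ = 1)
    (v : EuclideanSpace ℝ (Fin n)) :
    toEuclideanCLM (𝕜 := ℝ) M (toEuclideanCLM (𝕜 := ℝ) M⁻¹ v) = v := by
  have : toEuclideanCLM (𝕜 := ℝ) M * toEuclideanCLM (𝕜 := ℝ) M⁻¹ = 1 := by
    rw [← map_mul, h, map_one]
  exact DFunLike.congr_fun this v

/-- After training on the source data, the residual on the target data is essentially the
difference between the transferred and the actual labels. -/
theorem norm_transferred_residual_le {HP : Matrix (Fin nP) (Fin nP) ℝ}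
    {HPQ : Matrix (Fin nP) (Fin nQ) ℝ} {η lam L : ℝ}
    (hH : Coercive (toEuclideanCLM (𝕜 := ℝ) HP) lam L) (hHinv : HP * HP⁻¹ = 1)
    (hHPQ : ∀ i j, |HPQ i j| ≤ 1)
    (hm : 0 < m) (hnP : 0 < nP) (hnQ : 0 < nQ) (ha : ∀ r, |a r| = 1)
    (hxP : ∀ i, ‖xP i‖ = 1) (hxQ : ∀ i, ‖xQ i‖ = 1) (hη : 0 < η)
    (hlam : 0 < lam) (hηL : η * L ^ 2 ≤ lam) (hηlam : η * lam ≤ 1) (hlam1 : lam ≤ 1)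
    {R τ γ X : ℝ} (hτ : 0 ≤ τ) (hX : 10 ≤ X) (hXτ : X ^ 5 * τ ≤ 1)
    (hXP : (nP : ℝ) ≤ X) (hXQ : (nQ : ℝ) ≤ X) (hXlam : lam⁻¹ ≤ X)
    (hγ : X ^ 2 * γ ≤ τ ^ 2) (hR : R = X ^ 14 / √(m : ℝ))
    (hsP : ∀ i, nearFrac W₀ R (xP i) ≤ τ ^ 2) (hsQ : ∀ i, nearFrac W₀ R (xQ i) ≤ τ ^ 2)
    (hGP : ∀ i j, |inner ℝ (feat a W₀ (xP i)) (feat a W₀ (xP j)) - HP i j| ≤ γ)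
    (hGPQ : ∀ i j, |inner ℝ (feat a W₀ (xP i)) (feat a W₀ (xQ j)) - HPQ i j| ≤ γ)
    (hrP : ‖residual a xP yP W₀‖ ≤ X ^ 5) (K : ℕ)
    (hK : (1 - η * lam / 4) ^ K ≤ τ) :
    (∀ s, ‖gradDescent a xP yP η W₀ K s - W₀ s‖ ≤ X ^ 8 / √(m : ℝ)) ∧
    ‖residual a xQ yQ (gradDescent a xP yP η W₀ K) - (residual a xQ yQ W₀ -
      WithLp.toLp 2 (HPQᵀ *ᵥ (toEuclideanCLM (𝕜 := ℝ) HP⁻¹ (residual a xP yP W₀))))‖ ≤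
        X ^ 14 * τ := by
  have hX0 : 0 < X := by linarith
  have hX1 : 1 ≤ X := by linarith
  have hnP1 : (1 : ℝ) ≤ nP := by exact_mod_cast hnP
  have hnQ1 : (1 : ℝ) ≤ nQ := by exact_mod_cast hnQ
  have hγ0 : 0 ≤ γ := (abs_nonneg _).trans (hGP ⟨0, hnP⟩ ⟨0, hnP⟩)
  have hτ1 : τ ≤ 1 := le_trans (by nlinarith [one_le_pow₀ hX1 (n := 5)]) hXτ
  have hτ2 : τ ^ 2 ≤ τ := by nlinarith
  have hsm : 0 < √(m : ℝ) := by positivity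
  set H := toEuclideanCLM (𝕜 := ℝ) HP with hHdef
  have hG : ∀ v, ‖H v - featAdj a W₀ xP (featSum a W₀ xP v)‖ ≤ τ ^ 2 * ‖v‖ := by
    intro v
    refine (norm_sub_featAdj_le hGP v).trans ?_
    gcongr
    refine le_trans ?_ hγ
    gcongr
  have hB : 4 / lam * ‖residual a xP yP W₀‖ ≤ X ^ 7 := by
    calc 4 / lam * ‖residual a xP yP W₀‖ = 4 * lam⁻¹ * ‖residual a xP yP W₀‖ := by ring
      _ ≤ X * X * X ^ 5 := by gcongr; linarith
      _ = _ := by ring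
  have hτ3 : 3 * (nP : ℝ) ^ 2 * τ ≤ lam / 4 :=
    three_mul_sq_mul_le hlam hτ hX hXτ hXP (Nat.cast_nonneg _) hXlam
  have hR1 : nP / √(m : ℝ) * (4 / lam * ‖residual a xP yP W₀‖) ≤ X ^ 8 / √(m : ℝ) := by
    calc _ ≤ X / √(m : ℝ) * X ^ 7 := by gcongr
      _ = _ := by ring
  have hR2 : X ^ 8 / √(m : ℝ) ≤ R := by
    rw [hR]; gcongr 1
    exact pow_le_pow_right₀ hX1 (by norm_num)
  obtain ⟨h1, h2, h3, h4, -, h6⟩ := gradDescent_stage hH hm hnP ha hxP hη hlam hηL hηlam hτ hτ3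
    hlam1 hsP hG (W := W₀) (R₁ := 0) (by simp) (by rw [zero_add]; exact hR1.trans hR2) K (y := yP)
  set W := gradDescent a xP yP η W₀ K with hW
  set T : EuclideanSpace ℝ (Fin nP) :=
    η • ∑ k ∈ Finset.range K, residual a xP yP (gradDescent a xP yP η W₀ k) with hT
  have hr0 : residual a xP yP (gradDescent a xP yP η W₀ 0) = residual a xP yP W₀ := rfl
  simp only [hr0] at h1 h2 h3 h4 h6
  set r₀ := residual a xP yP W₀ with hr₀
  have hnear : ∀ s, ‖W s - W₀ s‖ ≤ X ^ 8 / √(m : ℝ) := fun s => (h1 s).trans hR1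
  have h6' : ‖T‖ ≤ X ^ 7 := h6.trans hB
  refine ⟨hnear, ?_⟩
  set U := toEuclideanCLM (𝕜 := ℝ) HP⁻¹ r₀ with hU
  have hHU : H U = r₀ := mul_inv_toEuclideanCLM hHinv r₀
  -- Source training has converged up to `τ`, so `H T` is close to `r₀ = H U`; coercivity inverts
  -- `H` at the cost of one factor `lam⁻¹ ≤ X`.
  have hTU : ‖T - U‖ ≤ X ^ 12 * τ := by
    have e1 : H (T - U) = -(r₀ - residual a xP yP W - H T) - residual a xP yP W := by
      rw [map_sub, hHU]; abel
    have e2 : ‖H (T - U)‖ ≤ X ^ 11 * τ := by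
      rw [e1]
      refine (norm_sub_le _ _).trans ?_
      rw [norm_neg]
      have f1 : 3 * (nP : ℝ) ^ 2 * τ * (4 / lam * ‖r₀‖) ≤ X * X ^ 2 * τ * X ^ 7 := by
        gcongr; linarith
      have f2 : ‖residual a xP yP W‖ ≤ τ * X ^ 5 := h2.trans (by gcongr)
      have f3 : τ * X ^ 5 ≤ τ * X ^ 10 :=
        mul_le_mul_of_nonneg_left (pow_le_pow_right₀ hX1 (by norm_num)) hτ
      have f4 : 10 * X ^ 10 * τ ≤ X ^ 11 * τ :=
        mul_le_mul_of_nonneg_right (ten_mul_pow_le hX (by norm_num)) hτ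
      have f5 : 0 ≤ X ^ 10 * τ := by positivity
      have f6 : X * X ^ 2 * τ * X ^ 7 = X ^ 10 * τ := by ring
      linarith
    have e3 := hH.le_norm (T - U)
    calc ‖T - U‖ = lam⁻¹ * (lam * ‖T - U‖) := by field_simp
      _ ≤ X * (X ^ 11 * τ) :=
        mul_le_mul hXlam (e3.trans e2) (by positivity) hX0.le
      _ = _ := by ring
  set e₁ : EuclideanSpace ℝ (Fin nQ) :=
    residual a xQ yQ W - (residual a xQ yQ W₀ - WithLp.toLp 2 (HPQᵀ *ᵥ T)) with he₁
  have hcoord : ‖e₁‖ ≤ X ^ 10 * τ := by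
    have hc : ∀ i, |e₁ i| ≤ X ^ 9 * τ := by
      intro i
      have g1 := abs_network_sub_sub_le ha (hxQ i) (W := W₀) (W' := W) (W₀ := W₀) (R := R)
        (by simp only [sub_self, norm_zero]; intro; exact (by positivity : 0 ≤ X ^ 8 / √(m : ℝ)).trans hR2)
        (fun s => (hnear s).trans hR2) hnear
      have g2 : √(m : ℝ) * nearFrac W₀ R (xQ i) * (X ^ 8 / √(m : ℝ)) ≤ X ^ 8 * τ := by
        calc _ = X ^ 8 * nearFrac W₀ R (xQ i) := by field_simp
          _ ≤ X ^ 8 * τ := by gcongr; exact (hsQ i).trans hτ2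
      have g3 : |inner ℝ (feat a W₀ (xQ i))
          ((WithLp.toLp 2 (W - W₀) : FrobSpace d m) + featSum a W₀ xP T)| ≤ X ^ 8 * τ := by
        refine (abs_real_inner_le_norm _ _).trans ?_
        have := norm_feat_le (W := W₀) hm ha (hxQ i)
        calc _ ≤ 1 * (nP * τ * (4 / lam * ‖r₀‖)) := by gcongr
          _ ≤ 1 * (X * τ * X ^ 7) := by gcongr
          _ = _ := by ring
      have g4 : |∑ j, T j * (inner ℝ (feat a W₀ (xP j)) (feat a W₀ (xQ i)) - HPQ j i)| ≤
          X ^ 8 * τ := by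
        calc _ ≤ ∑ j, |T j| * γ := by
              refine (Finset.abs_sum_le_sum_abs _ _).trans (Finset.sum_le_sum fun j _ => ?_)
              rw [abs_mul]
              gcongr
              exact hGPQ j i
          _ ≤ nP * ‖T‖ * γ := by rw [← Finset.sum_mul]; gcongr; exact sum_abs_le T
          _ ≤ X * X ^ 7 * γ := by gcongr
          _ = X ^ 6 * (X ^ 2 * γ) := by ring
          _ ≤ X ^ 8 * τ := mul_le_mul (pow_le_pow_right₀ hX1 (by norm_num)) (hγ.trans hτ2)
              (by positivity) (by positivity)
      -- The error in a target output: nonlinearity, deviation of the displacement from `-featSum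
      -- T`, and the cross Gram matrix against its limit.
      have g5 : e₁ i = (network a W (xQ i) - network a W₀ (xQ i) -
          inner ℝ (feat a W₀ (xQ i)) (WithLp.toLp 2 (W - W₀) : FrobSpace d m)) +
          inner ℝ (feat a W₀ (xQ i))
            ((WithLp.toLp 2 (W - W₀) : FrobSpace d m) + featSum a W₀ xP T) -
          ∑ j, T j * (inner ℝ (feat a W₀ (xP j)) (feat a W₀ (xQ i)) - HPQ j i) := by
        simp only [he₁, residual, PiLp.sub_apply, inner_add_right, featSum, inner_sum,
          real_inner_smul_right, mul_sub, Finset.sum_sub_distrib, mulVec, dotProduct,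
          transpose_apply]
        simp only [mul_comm (T _), real_inner_comm (feat a W₀ (xQ i))]
        ring
      rw [g5]
      refine (abs_sub _ _).trans ((add_le_add (abs_add_le _ _) le_rfl).trans ?_)
      have g6 : 10 * X ^ 8 * τ ≤ X ^ 9 * τ :=
        mul_le_mul_of_nonneg_right (ten_mul_pow_le hX (by norm_num)) hτ
      have g7 : 0 ≤ X ^ 8 * τ := by positivity
      linarith [g1.trans g2]
    calc _ ≤ nQ * (X ^ 9 * τ) := norm_le_of_abs_le _ hc
      _ ≤ X * (X ^ 9 * τ) := by gcongr
      _ = _ := by ring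
  have hfin : residual a xQ yQ W - (residual a xQ yQ W₀ -
      WithLp.toLp 2 (HPQᵀ *ᵥ U)) = e₁ - WithLp.toLp 2 (HPQᵀ *ᵥ (T - U)) := by
    rw [he₁, mulVec_sub, WithLp.toLp_sub]
    abel
  rw [hfin]
  have hlast : ‖(WithLp.toLp 2 (HPQᵀ *ᵥ (T - U)) : EuclideanSpace ℝ (Fin nQ))‖ ≤
      X ^ 13 * τ := by
    refine (norm_mulVec_le HPQᵀ (fun i j => hHPQ j i) (T - U)).trans ?_
    have q1 : √(nQ : ℝ) * √(nP : ℝ) ≤ X := by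
      calc _ ≤ √X * √X := by gcongr
        _ = X := Real.mul_self_sqrt hX0.le
    calc _ ≤ X * (X ^ 12 * τ) := by gcongr
      _ = _ := by ring
  refine (norm_sub_le _ _).trans ?_
  have i1 : X ^ 10 * τ ≤ X ^ 13 * τ :=
    mul_le_mul_of_nonneg_right (pow_le_pow_right₀ hX1 (by norm_num)) hτ
  have i2 : 10 * X ^ 13 * τ ≤ X ^ 14 * τ :=
    mul_le_mul_of_nonneg_right (ten_mul_pow_le hX (by norm_num)) hτ
  have i3 : 0 ≤ X ^ 13 * τ := by positivity
  linarith

set_option maxHeartbeats 1000000 in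
/-- The transfer bound on the event that the random initialization is well behaved. -/
theorem frobNorm_transfer_le {HP : Matrix (Fin nP) (Fin nP) ℝ} {HQ : Matrix (Fin nQ) (Fin nQ) ℝ}
    {HPQ : Matrix (Fin nP) (Fin nQ) ℝ} {η lamP lamQ : ℝ}
    (hHP : Coercive (toEuclideanCLM (𝕜 := ℝ) HP) lamP nP) (hHPinv : HP * HP⁻¹ = 1)
    (hHQ : Coercive (toEuclideanCLM (𝕜 := ℝ) HQ) lamQ nQ) (hHQinv : HQ * HQ⁻¹ = 1)
    (hHPQ : ∀ i j, |HPQ i j| ≤ 1)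
    (hm : 0 < m) (hnP : 0 < nP) (hnQ : 0 < nQ) (ha : ∀ r, |a r| = 1)
    (hxP : ∀ i, ‖xP i‖ = 1) (hyP : ∀ i, |yP i| ≤ 1)
    (hxQ : ∀ i, ‖xQ i‖ = 1) (hyQ : ∀ i, |yQ i| ≤ 1) (hη : 0 < η)
    (hlamP : 0 < lamP) (hlamP1 : lamP ≤ 1) (hlamQ : 0 < lamQ) (hlamQ1 : lamQ ≤ 1)
    (hηP : η ≤ lamP / (nP : ℝ) ^ 2) (hηQ : η ≤ lamQ / (nQ : ℝ) ^ 2)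
    {R τ γ X UP UQ : ℝ} (hτ : 0 ≤ τ) (hX : 10 ≤ X) (hXτ : X ^ 5 * τ ≤ 1)
    (hXP : (nP : ℝ) ≤ X) (hXQ : (nQ : ℝ) ≤ X) (hXlamP : lamP⁻¹ ≤ X) (hXlamQ : lamQ⁻¹ ≤ X)
    (hγ : X ^ 2 * γ ≤ τ ^ 2) (hR : R = X ^ 14 / √(m : ℝ))
    (hsP : ∀ i, nearFrac W₀ R (xP i) ≤ τ ^ 2) (hsQ : ∀ i, nearFrac W₀ R (xQ i) ≤ τ ^ 2)
    (hGP : ∀ i j, |inner ℝ (feat a W₀ (xP i)) (feat a W₀ (xP j)) - HP i j| ≤ γ)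
    (hGQ : ∀ i j, |inner ℝ (feat a W₀ (xQ i)) (feat a W₀ (xQ j)) - HQ i j| ≤ γ)
    (hGPQ : ∀ i j, |inner ℝ (feat a W₀ (xP i)) (feat a W₀ (xQ j)) - HPQ i j| ≤ γ)
    (hUP : ‖residual a xP 0 W₀‖ ≤ UP) (hUQ : ‖residual a xQ 0 W₀‖ ≤ UQ)
    (hUPX : UP ≤ X ^ 4) (hUQX : UQ ≤ X ^ 4) (KP KQ : ℕ)
    (hK : (1 - η * lamP / 4) ^ KP ≤ τ) :
    frobNorm (gradDescent a xQ yQ η (gradDescent a xP yP η W₀ KP) KQ -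
        gradDescent a xP yP η W₀ KP) ≤
      √((yQ - HPQᵀ *ᵥ (HP⁻¹ *ᵥ yP)) ⬝ᵥ (HQ⁻¹ *ᵥ (yQ - HPQᵀ *ᵥ (HP⁻¹ *ᵥ yP)))) +
        (UQ + √(nQ : ℝ) * √(nP : ℝ) * (UP / lamP)) / lamQ + X ^ 18 * τ := by
  have hX0 : 0 < X := by linarith
  have hX1 : 1 ≤ X := by linarith
  have hnP1 : (1 : ℝ) ≤ nP := by exact_mod_cast hnP
  have hnQ1 : (1 : ℝ) ≤ nQ := by exact_mod_cast hnQ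
  have hsm : 0 < √(m : ℝ) := by positivity
  have hη2 : ∀ {n lam : ℝ}, 1 ≤ n → 0 < lam → lam ≤ 1 → η ≤ lam / n ^ 2 →
      η * n ^ 2 ≤ lam ∧ η * n ≤ 1 ∧ η * lam ≤ 1 := by
    intro n lam hn hl hl1 h
    have h1 : η * n ^ 2 ≤ lam := (le_div_iff₀ (by positivity)).1 h
    have h2 : η * n ≤ η * n ^ 2 := by gcongr; exact le_self_pow₀ hn (by norm_num)
    have h3 : η * lam ≤ η * n := by gcongr; linarith
    exact ⟨h1, by linarith, by linarith⟩
  obtain ⟨hηP1, hηP2, hηP3⟩ := hη2 hnP1 hlamP hlamP1 hηP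
  obtain ⟨hηQ1, hηQ2, hηQ3⟩ := hη2 hnQ1 hlamQ hlamQ1 hηQ
  have hy : ∀ {n : ℕ} {y : Fin n → ℝ}, (∀ i, |y i| ≤ 1) → (n : ℝ) ≤ X →
      ‖(WithLp.toLp 2 y : EuclideanSpace ℝ (Fin n))‖ ≤ X := by
    intro n y h1 h2
    have := norm_le_of_abs_le (WithLp.toLp 2 y) h1
    linarith
  have hres : ∀ {n : ℕ} (x : Fin n → Input d) (y : Fin n → ℝ), residual a x y W₀ =
      residual a x 0 W₀ - WithLp.toLp 2 y := by
    intro n x y; ext i; simp [residual]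
  have hXX : ∀ {i j : ℕ}, i ≤ j → X ^ i ≤ X ^ j := fun h => pow_le_pow_right₀ hX1 h
  have hrP : ‖residual a xP yP W₀‖ ≤ X ^ 5 := by
    rw [hres]
    refine (norm_sub_le _ _).trans ?_
    have h4 := ten_mul_pow_le hX (show 4 < 5 by norm_num)
    have h1 : X ≤ X ^ 4 := le_self_pow₀ hX1 (by norm_num)
    have := hy hyP hXP
    linarith [pow_pos hX0 4, hUP.trans hUPX]
  obtain ⟨hnear, hrQ⟩ := norm_transferred_residual_le (yQ := yQ) hHP hHPinv hHPQ hm hnP hnQ ha hxP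
    hxQ hη hlamP hηP1 hηP3 hlamP1 hτ hX hXτ hXP hXQ hXlamP hγ hR hsP hsQ hGP hGPQ hrP KP hK
  set W := gradDescent a xP yP η W₀ KP
  set H := toEuclideanCLM (𝕜 := ℝ) HQ with hHdef
  set v : EuclideanSpace ℝ (Fin nQ) := WithLp.toLp 2 (yQ - HPQᵀ *ᵥ (HP⁻¹ *ᵥ yP)) with hv
  set uP := residual a xP 0 W₀ with huP
  set uQ := residual a xQ 0 W₀ with huQ
  have hinvle : ∀ w, ‖toEuclideanCLM (𝕜 := ℝ) HP⁻¹ w‖ ≤ ‖w‖ / lamP := by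
    intro w
    rw [le_div_iff₀ hlamP, mul_comm]
    have := hHP.le_norm (toEuclideanCLM (𝕜 := ℝ) HP⁻¹ w)
    rwa [mul_inv_toEuclideanCLM hHPinv] at this
  -- A residual is prediction minus label, so the ideal target residual is `-v`; `e` collects the
  -- initial outputs and the linearization error.
  set e : EuclideanSpace ℝ (Fin nQ) := residual a xQ yQ W + v with he
  have hHle : ∀ w, ‖(WithLp.toLp 2 (HPQᵀ *ᵥ (toEuclideanCLM (𝕜 := ℝ) HP⁻¹ w)) :
      EuclideanSpace ℝ (Fin nQ))‖ ≤ √(nQ : ℝ) * √(nP : ℝ) * (‖w‖ / lamP) := by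
    intro w
    refine (norm_mulVec_le HPQᵀ (fun i j => hHPQ j i) _).trans ?_
    gcongr
    exact hinvle w
  have hnn : √(nQ : ℝ) * √(nP : ℝ) ≤ X := by
    calc _ ≤ √X * √X := by gcongr
      _ = X := Real.mul_self_sqrt hX0.le
  have hsplit : e = (residual a xQ yQ W - (residual a xQ yQ W₀ -
      WithLp.toLp 2 (HPQᵀ *ᵥ (toEuclideanCLM (𝕜 := ℝ) HP⁻¹ (residual a xP yP W₀))))) +
      (uQ - WithLp.toLp 2 (HPQᵀ *ᵥ (toEuclideanCLM (𝕜 := ℝ) HP⁻¹ uP))) := by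
    rw [he, hres xQ yQ, hres xP yP, hv, map_sub, WithLp.ofLp_sub, mulVec_sub, WithLp.toLp_sub,
      WithLp.toLp_sub, toEuclideanCLM_toLp]
    abel
  have hele : ‖e‖ ≤ X ^ 14 * τ + (UQ + √(nQ : ℝ) * √(nP : ℝ) * (UP / lamP)) := by
    rw [hsplit]
    refine (norm_add_le _ _).trans (add_le_add hrQ ((norm_sub_le _ _).trans
      (add_le_add hUQ ((hHle uP).trans ?_))))
    gcongr
  have hvle : ‖v‖ ≤ X + X * (X * X) := by
    rw [hv, WithLp.toLp_sub]
    refine (norm_sub_le _ _).trans (add_le_add (hy hyQ hXQ) ?_)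
    have := hHle (WithLp.toLp 2 yP)
    rw [toEuclideanCLM_toLp] at this
    refine this.trans ?_
    rw [div_eq_mul_inv]
    gcongr
    exact hy hyP hXP
  have hrle : ‖residual a xQ yQ W‖ ≤ X ^ 10 := by
    have e1 : residual a xQ yQ W = e - v := by rw [he]; abel
    rw [e1]
    refine (norm_sub_le _ _).trans ((add_le_add hele hvle).trans ?_)
    have f1 : X ^ 14 * τ ≤ X ^ 9 := by
      calc X ^ 14 * τ = X ^ 9 * (X ^ 5 * τ) := by ring
        _ ≤ X ^ 9 * 1 := by gcongr
        _ = _ := mul_one _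
    have f2 : √(nQ : ℝ) * √(nP : ℝ) * (UP / lamP) ≤ X ^ 9 := by
      have : 0 ≤ UP := (norm_nonneg _).trans hUP
      calc _ ≤ X * (X ^ 4 * X) := by rw [div_eq_mul_inv]; gcongr
        _ = X ^ 6 := by ring
        _ ≤ _ := hXX (by norm_num)
    have f3 : X ^ 4 ≤ X ^ 9 := hXX (by norm_num)
    have f4 : X ≤ X ^ 9 := le_self_pow₀ hX1 (by norm_num)
    have f5 : X * (X * X) ≤ X ^ 9 := by
      calc X * (X * X) = X ^ 3 := by ring
        _ ≤ _ := hXX (by norm_num)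
    have f6 := ten_mul_pow_le hX (show 9 < 10 by norm_num)
    linarith [pow_pos hX0 9]
  obtain ⟨B, hBdef⟩ : ∃ B, 4 / lamQ * ‖residual a xQ yQ W‖ = B := ⟨_, rfl⟩
  have hB0 : 0 ≤ B := by rw [← hBdef]; positivity
  have hBle : B ≤ X ^ 12 := by
    calc B = 4 * lamQ⁻¹ * ‖residual a xQ yQ W‖ := by rw [← hBdef]; ring
      _ ≤ X * X * X ^ 10 := by gcongr; linarith
      _ = _ := by ring
  have hG : ∀ v, ‖H v - featAdj a W₀ xQ (featSum a W₀ xQ v)‖ ≤ τ ^ 2 * ‖v‖ := by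
    intro v
    refine (norm_sub_featAdj_le hGQ v).trans ?_
    have hγ0 : 0 ≤ γ := (abs_nonneg _).trans (hGP ⟨0, hnP⟩ ⟨0, hnP⟩)
    gcongr
    refine le_trans ?_ hγ
    gcongr
  have hτ3 : 3 * (nQ : ℝ) ^ 2 * τ ≤ lamQ / 4 :=
    three_mul_sq_mul_le hlamQ hτ hX hXτ hXQ (Nat.cast_nonneg _) hXlamQ
  -- The displacements of both stages fit into one ball around `W₀`, so a single linearization point
  -- serves source and target.
  have hRle : X ^ 8 / √(m : ℝ) + nQ / √(m : ℝ) * (4 / lamQ * ‖residual a xQ yQ W‖) ≤ R := by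
    rw [hBdef, hR]
    have h1 : nQ / √(m : ℝ) * B ≤ X ^ 13 / √(m : ℝ) := by
      calc nQ / √(m : ℝ) * B ≤ X / √(m : ℝ) * X ^ 12 := by gcongr
        _ = _ := by ring
    refine (add_le_add le_rfl h1).trans ?_
    rw [← add_div]
    gcongr
    have h2 := ten_mul_pow_le hX (show 8 < 14 by norm_num)
    have h3 := ten_mul_pow_le hX (show 13 < 14 by norm_num)
    linarith [pow_pos hX0 8, pow_pos hX0 13, pow_pos hX0 14]
  -- The energy of the first summand is the main term; that of the second is at most `‖e‖ / lamQ`.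
  have hS : H (-toEuclideanCLM (𝕜 := ℝ) HQ⁻¹ v + toEuclideanCLM (𝕜 := ℝ) HQ⁻¹ e) =
      residual a xQ yQ W := by
    rw [map_add, map_neg, mul_inv_toEuclideanCLM hHQinv, mul_inv_toEuclideanCLM hHQinv, he]
    abel
  refine (norm_gradDescent_sub_le_energy hHQ hm hnQ ha hxQ hη hlamQ hηQ1 hηQ2 hηQ3 hτ hτ3 hlamQ1
    hsQ hG hnear hRle hBdef _ hS KQ).trans ?_
  have hen1 := hHQ.energy_add_le hlamQ (-toEuclideanCLM (𝕜 := ℝ) HQ⁻¹ v)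
    (toEuclideanCLM (𝕜 := ℝ) HQ⁻¹ e)
  rw [energy_neg] at hen1
  have hen2 : energy H (toEuclideanCLM (𝕜 := ℝ) HQ⁻¹ v) =
      √((yQ - HPQᵀ *ᵥ (HP⁻¹ *ᵥ yP)) ⬝ᵥ (HQ⁻¹ *ᵥ (yQ - HPQᵀ *ᵥ (HP⁻¹ *ᵥ yP)))) := by
    rw [energy, mul_inv_toEuclideanCLM hHQinv, inner_toEuclideanCLM]
  have hen3 := hHQ.energy_le hlamQ hlamQ1 (toEuclideanCLM (𝕜 := ℝ) HQ⁻¹ e)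
  rw [mul_inv_toEuclideanCLM hHQinv] at hen3
  rw [hen2] at hen1
  have hen4 : ‖e‖ / lamQ ≤ X ^ 15 * τ +
      (UQ + √(nQ : ℝ) * √(nP : ℝ) * (UP / lamP)) / lamQ := by
    refine (div_le_div_of_nonneg_right hele hlamQ.le).trans ?_
    rw [add_div]
    gcongr
    calc X ^ 14 * τ / lamQ = X ^ 14 * τ * lamQ⁻¹ := div_eq_mul_inv _ _
      _ ≤ X ^ 14 * τ * X := by gcongr
      _ = _ := by ring
  obtain ⟨b, hbdef⟩ : ∃ b, 2 / lamQ * (3 * (nQ : ℝ) ^ 2 * τ * B) = b := ⟨_, rfl⟩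
  have hb0 : 0 ≤ b := by rw [← hbdef]; positivity
  have hb : b ≤ X ^ 16 * τ := by
    calc b = 6 * lamQ⁻¹ * (nQ ^ 2 * τ * B) := by rw [← hbdef]; ring
      _ ≤ X * X * (X ^ 2 * τ * X ^ 12) := by gcongr; linarith
      _ = X ^ 16 * τ := by ring
  rw [hbdef]
  have hτ1 : τ ≤ 1 := le_trans (by nlinarith [one_le_pow₀ hX1 (n := 5)]) hXτ
  have k1 : nQ * τ * B ≤ X ^ 13 * τ := by
    calc nQ * τ * B ≤ X * τ * X ^ 12 := by gcongr
      _ = _ := by ring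
  have k2 : nQ * b ≤ X ^ 17 * τ := by
    calc nQ * b ≤ X * (X ^ 16 * τ) := by gcongr
      _ = _ := by ring
  have k3 : τ * (B + b) ≤ X ^ 12 * τ + X ^ 16 * τ := by
    calc τ * (B + b) = B * τ + τ * b := by ring
      _ ≤ X ^ 12 * τ + 1 * (X ^ 16 * τ) := by gcongr
      _ = _ := by ring
  have up : ∀ i ≤ 17, X ^ i * τ ≤ X ^ 17 * τ := fun i hi =>
    mul_le_mul_of_nonneg_right (hXX hi) hτ
  have k4 : 10 * X ^ 17 * τ ≤ X ^ 18 * τ :=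
    mul_le_mul_of_nonneg_right (ten_mul_pow_le hX (by norm_num)) hτ
  have k5 : 0 ≤ X ^ 17 * τ := by positivity
  linarith [up 13 (by norm_num), up 12 (by norm_num), up 16 (by norm_num), up 15 (by norm_num)]

end Transfer

/-! ### Moments of the random initialization. -/

section Probability

variable {d m n n' : ℕ} {κ : ℝ}

/-- The law of a single input weight vector. -/
abbrev weightLaw (d : ℕ) (κ : ℝ) : Measure (Input d) :=
  multivariateGaussian (0 : Input d) (κ ^ 2 • 1)

/-- The law of a single output weight. -/
abbrev signLaw : Measure ℝ := uniformOn ({-1, 1} : Set ℝ)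

instance : IsProbabilityMeasure signLaw :=
  isProbabilityMeasure_uniformOn (Set.toFinite _) ⟨1, by simp⟩

theorem signLaw_ae : ∀ᵐ a ∂signLaw, a = -1 ∨ a = 1 := by
  have h := uniformOn_self (s := ({-1, 1} : Set ℝ)) (Set.toFinite _) ⟨1, by simp⟩
  have h2 : MeasurableSet ({-1, 1} : Set ℝ) := (Set.toFinite _).measurableSet
  exact (mem_ae_iff_prob_eq_one h2).2 h

/-- Centred signs make the units cancel: the initial output has second moment at most `κ ^ 2`,
uniformly in `m`. -/
theorem integral_signLaw : ∫ a, a ∂signLaw = 0 := by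
  have h : signLaw = (2 : ENNReal)⁻¹ • Measure.count.restrict ({-1, 1} : Set ℝ) := by
    rw [signLaw, uniformOn, ProbabilityTheory.cond, Measure.count_apply (Set.toFinite _).measurableSet]
    congr 2
    rw [Set.encard_pair (by norm_num)]
    rfl
  have h3 : (({-1, 1} : Finset ℝ) : Set ℝ) = {-1, 1} := by simp
  have hint : IntegrableOn (fun a : ℝ => a) (({-1, 1} : Finset ℝ) : Set ℝ) Measure.count := by
    rw [h3, Set.insert_eq]
    exact (integrableOn_singleton (hx := by simp)).union
      (integrableOn_singleton (hx := by simp))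
  rw [h, integral_smul_measure, ← h3, setIntegral_finset _ hint,
    Finset.sum_pair (by norm_num)]
  simp

theorem posSemidef_smul_one : (κ ^ 2 • (1 : Matrix (Fin d) (Fin d) ℝ)).PosSemidef :=
  PosSemidef.one.smul (sq_nonneg κ)

/-- Compared through characteristic functions. Activations are invariant under positive scaling, so
the limiting Gram matrix does not depend on `κ`. -/
theorem weightLaw_eq_map (hκ : 0 < κ) :
    weightLaw d κ = (stdGaussian (Input d)).map fun w => κ • w := by
  have : IsProbabilityMeasure ((stdGaussian (Input d)).map fun w => κ • w) :=
    Measure.isProbabilityMeasure_map (by fun_prop)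
  apply Measure.ext_of_charFun
  ext t
  rw [charFun_multivariateGaussian posSemidef_smul_one, charFun_map_smul, charFun_stdGaussian]
  congr 1
  have h : (t : Fin d → ℝ) ⬝ᵥ t = ‖t‖ ^ 2 := by
    rw [EuclideanSpace.real_norm_sq_eq]; simp [dotProduct, pow_two]
  rw [smul_mulVec, one_mulVec, dotProduct_smul, h, norm_smul, Real.norm_of_nonneg hκ.le]
  simp
  ring

theorem integrable_weightLaw_sq (x : Input d) :
    MemLp (fun w : Input d => (inner ℝ w x : ℝ)) 2 (weightLaw d κ) := by
  have := IsGaussian.memLp_dual (weightLaw d κ) (innerSL ℝ x) 2 (by simp)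
  refine this.congr_norm (by fun_prop) (.of_forall fun w => ?_)
  simp [real_inner_comm]

theorem weightLaw_map_inner {x : Input d} (hx : ‖x‖ = 1) :
    (weightLaw d κ).map (fun w => (inner ℝ w x : ℝ)) = gaussianReal 0 (κ ^ 2).toNNReal := by
  have h1 : (fun w : Input d => (inner ℝ w x : ℝ)) = innerSL ℝ x := by
    ext w; simp [real_inner_comm]
  have h3 : ∫ w, innerSL ℝ x w ∂(weightLaw d κ) = 0 := by
    rw [ContinuousLinearMap.integral_comp_comm _ IsGaussian.integrable_fun_id,
      integral_id_multivariateGaussian, map_zero]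
  have h2 : Var[innerSL ℝ x; weightLaw d κ] = κ ^ 2 := by
    rw [← covariance_self (by fun_prop)]
    have := covarianceBilin_multivariateGaussian (μ := 0) (posSemidef_smul_one (d := d) (κ := κ)) x x
    rw [covarianceBilin_apply_eq_cov IsGaussian.memLp_two_id] at this
    have h : (x : Fin d → ℝ) ⬝ᵥ x = 1 := by
      have h := EuclideanSpace.real_norm_sq_eq x
      rw [hx] at h
      simpa [dotProduct, pow_two] using h.symm
    rw [smul_mulVec, one_mulVec, dotProduct_smul, h, smul_eq_mul, mul_one] at this
    exact this
  rw [h1, IsGaussian.map_eq_gaussianReal, h2]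
  simp only [h3]

theorem integral_inner_sq {x : Input d} (hx : ‖x‖ = 1) :
    ∫ w, (inner ℝ w x : ℝ) ^ 2 ∂(weightLaw d κ) = κ ^ 2 := by
  have h1 : ∫ w, (inner ℝ w x : ℝ) ^ 2 ∂(weightLaw d κ) =
      ∫ z, z ^ 2 ∂((weightLaw d κ).map fun w => (inner ℝ w x : ℝ)) := by
    rw [integral_map (by fun_prop) (by fun_prop)]
  rw [h1, weightLaw_map_inner hx]
  have h2 := variance_fun_id_gaussianReal (μ := 0) (v := (κ ^ 2).toNNReal)
  rw [variance_eq_integral (by fun_prop)] at h2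
  simpa [Real.coe_toNNReal _ (sq_nonneg κ)] using h2

/-- Anticoncentration: the density is at most `1/(2κ)`, since `√(2π) ≥ 2`, and the interval has
length `2R`. -/
theorem gaussianReal_Icc_le (hκ : 0 < κ) {R : ℝ} (hR : 0 ≤ R) :
    (gaussianReal 0 (κ ^ 2).toNNReal).real (Set.Icc (-R) R) ≤ R / κ := by
  have hv : (κ ^ 2).toNNReal ≠ 0 := by
    simp [hκ.ne']
  have h1 : ∀ z, gaussianPDFReal 0 (κ ^ 2).toNNReal z ≤ 1 / (2 * κ) := by
    intro z
    rw [gaussianPDFReal, Real.coe_toNNReal _ (sq_nonneg κ), one_div]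
    have h2 : 2 * κ ≤ √(2 * Real.pi * κ ^ 2) := by
      refine Real.le_sqrt_of_sq_le ?_
      nlinarith [Real.pi_gt_three, sq_nonneg κ]
    have h3 : Real.exp (-(z - 0) ^ 2 / (2 * κ ^ 2)) ≤ 1 := by
      rw [Real.exp_le_one_iff]
      exact div_nonpos_of_nonpos_of_nonneg (by nlinarith [sq_nonneg (z - 0)]) (by positivity)
    calc _ ≤ (2 * κ)⁻¹ * 1 := by gcongr
      _ = _ := mul_one _
  rw [measureReal_def, gaussianReal_apply_eq_integral _ hv, ENNReal.toReal_ofReal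
    (integral_nonneg fun _ => gaussianPDFReal_nonneg _ _ _)]
  calc ∫ z in Set.Icc (-R) R, gaussianPDFReal 0 (κ ^ 2).toNNReal z
      ≤ ∫ _z in Set.Icc (-R) R, 1 / (2 * κ) := by
        refine integral_mono (integrable_gaussianPDFReal _ _).integrableOn
          (integrableOn_const (by simp)) h1
    _ = R / κ := by
        rw [setIntegral_const, measureReal_def, Real.volume_Icc, ENNReal.toReal_ofReal (by linarith)]
        simp only [smul_eq_mul]
        field_simp
        ring

/-- The joint law of the input and output weights of one hidden unit. -/
abbrev unitLaw (d : ℕ) (κ : ℝ) : Measure (Input d × ℝ) := (weightLaw d κ).prod signLaw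

/-- Regrouping input and output weights by hidden unit exhibits the initialization as `m`
independent copies of `unitLaw`. -/
theorem measurePreserving_initLaw : MeasurePreserving
    (MeasurableEquiv.arrowProdEquivProdArrow (Input d) ℝ (Fin m))
    (Measure.pi fun _ => unitLaw d κ) (initLaw d m κ) :=
  measurePreserving_arrowProdEquivProdArrow _ _ _ _ _

instance : IsProbabilityMeasure (initLaw d m κ) := by
  unfold initLaw; infer_instance

theorem initLaw_ae : ∀ᵐ ω ∂initLaw d m κ, ∀ r, |ω.2 r| = 1 := by
  have h1 : ∀ᵐ a ∂(Measure.pi fun _ : Fin m => signLaw), ∀ r, |a r| = 1 := by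
    rw [ae_all_iff]
    intro r
    refine (measurePreserving_eval (fun _ : Fin m => signLaw) r).quasiMeasurePreserving.ae
      (p := fun z => |z| = 1) ?_
    filter_upwards [signLaw_ae] with z hz
    rcases hz with rfl | rfl <;> simp
  exact Measure.quasiMeasurePreserving_snd.ae h1

/-- Expectation of an additive function of the hidden units. -/
theorem integral_sum_units {f : Input d × ℝ → ℝ} (hf : Integrable f (unitLaw d κ)) :
    Integrable (fun ω : Weights d m × (Fin m → ℝ) => ∑ r, f (ω.1 r, ω.2 r)) (initLaw d m κ) ∧
    ∫ ω, ∑ r, f (ω.1 r, ω.2 r) ∂(initLaw d m κ) = m * ∫ p, f p ∂(unitLaw d κ) := by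
  have hr : ∀ r : Fin m, Integrable (fun ω : Fin m → Input d × ℝ => f (ω r))
      (Measure.pi fun _ => unitLaw d κ) := fun r =>
    (measurePreserving_eval (fun _ : Fin m => unitLaw d κ) r).integrable_comp_of_integrable hf
  have he := measurePreserving_initLaw (d := d) (m := m) (κ := κ)
  constructor
  · rw [← he.integrable_comp_emb (MeasurableEquiv.measurableEmbedding _)]
    exact integrable_finsetSum _ fun r _ => hr r
  · rw [← he.integral_comp']
    change ∫ ω : Fin m → Input d × ℝ, ∑ r, f (ω r) ∂_ = _
    rw [integral_finsetSum _ fun r _ => hr r]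
    simp [integral_comp_eval (μ := fun _ : Fin m => unitLaw d κ) hf.aestronglyMeasurable]

/-- Mean square deviation of an additive function of the hidden units. -/
theorem integral_sum_units_sub_sq {f : Input d × ℝ → ℝ} (hf : MemLp f 2 (unitLaw d κ)) :
    Integrable (fun ω : Weights d m × (Fin m → ℝ) =>
      (∑ r, f (ω.1 r, ω.2 r) - m * ∫ p, f p ∂(unitLaw d κ)) ^ 2) (initLaw d m κ) ∧
    ∫ ω, (∑ r, f (ω.1 r, ω.2 r) - m * ∫ p, f p ∂(unitLaw d κ)) ^ 2 ∂(initLaw d m κ) ≤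
      m * ∫ p, f p ^ 2 ∂(unitLaw d κ) := by
  have hr : ∀ r : Fin m, MemLp (fun ω : Fin m → Input d × ℝ => f (ω r)) 2
      (Measure.pi fun _ => unitLaw d κ) := fun r =>
    hf.comp_measurePreserving (measurePreserving_eval (fun _ : Fin m => unitLaw d κ) r)
  have he := measurePreserving_initLaw (d := d) (m := m) (κ := κ)
  have hsum : MemLp (fun ω : Fin m → Input d × ℝ => ∑ r, f (ω r)) 2
      (Measure.pi fun _ => unitLaw d κ) := memLp_finsetSum _ fun r _ => hr r
  constructor
  · rw [← he.integrable_comp_emb (MeasurableEquiv.measurableEmbedding _)]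
    exact (hsum.sub (memLp_const (m * ∫ p, f p ∂(unitLaw d κ)))).integrable_sq
  · rw [← he.integral_comp']
    change ∫ ω : Fin m → Input d × ℝ, (∑ r, f (ω r) - m * ∫ p, f p ∂(unitLaw d κ)) ^ 2 ∂_ ≤ _
    have h1 : ∫ ω, ∑ r, f (ω r) ∂(Measure.pi fun _ : Fin m => unitLaw d κ) =
        m * ∫ p, f p ∂(unitLaw d κ) := by
      rw [integral_finsetSum _ fun r _ => (hr r).integrable (by norm_num)]
      simp [integral_comp_eval (μ := fun _ : Fin m => unitLaw d κ) hf.aestronglyMeasurable]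
    have h2 := variance_sum_pi (μ := fun _ : Fin m => unitLaw d κ) (X := fun _ => f) fun _ => hf
    have h3 : (∑ r : Fin m, fun ω : Fin m → Input d × ℝ => f (ω r)) =
        fun ω => ∑ r, f (ω r) := by ext; simp
    rw [h3, variance_eq_integral hsum.aestronglyMeasurable.aemeasurable, h1] at h2
    rw [h2, Finset.sum_const, Finset.card_univ, Fintype.card_fin, nsmul_eq_mul]
    gcongr
    exact variance_le_expectation_sq hf.aestronglyMeasurable

theorem markov_real {Ω : Type*} [MeasurableSpace Ω] {μ : Measure Ω} {Y : Ω → ℝ} (hY : 0 ≤ Y)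
    (hint : Integrable Y μ) {B t δ : ℝ} (hB : ∫ ω, Y ω ∂μ ≤ B) (ht : 0 < t) (hBt : B ≤ δ * t) :
    μ.real {ω | t ≤ Y ω} ≤ δ := by
  have := mul_meas_ge_le_integral_of_nonneg (.of_forall hY) hint t
  refine le_of_mul_le_mul_left ?_ ht
  linarith

theorem measurable_act (x : Input d) : Measurable fun w : Input d => act w x := by
  unfold act
  exact Measurable.ite (measurableSet_le measurable_const (by fun_prop)) measurable_const
    measurable_const

theorem act_nonneg (w x : Input d) : 0 ≤ act w x := by
  unfold act; split_ifs <;> simp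

theorem act_le_one (w x : Input d) : act w x ≤ 1 := by
  unfold act; split_ifs <;> simp

theorem act_smul (hκ : 0 < κ) (w x : Input d) : act (κ • w) x = act w x := by
  simp [act, real_inner_smul_left, mul_nonneg_iff_of_pos_left hκ]

theorem gramInf_apply (x : Fin n → Input d) (x' : Fin n' → Input d) (i : Fin n) (j : Fin n') :
    gramInf x x' i j =
      ∫ w, inner ℝ (x i) (x' j) * (act w (x i) * act w (x' j)) ∂(stdGaussian (Input d)) := by
  rw [gramInf, of_apply]
  congr 1
  ext w
  unfold act
  split_ifs <;> simp_all

theorem abs_gram_integrand_le {x x' : Input d} (hx : ‖x‖ = 1) (hx' : ‖x'‖ = 1) (w : Input d) :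
    |inner ℝ x x' * (act w x * act w x')| ≤ 1 := by
  have h1 := abs_real_inner_le_norm x x'
  rw [hx, hx', one_mul] at h1
  rw [abs_mul, abs_of_nonneg (mul_nonneg (act_nonneg w x) (act_nonneg w x'))]
  exact mul_le_one₀ h1 (mul_nonneg (act_nonneg w x) (act_nonneg w x'))
    (mul_le_one₀ (act_le_one w x) (act_nonneg w x') (act_le_one w x'))

theorem measurable_gram_integrand (x x' : Input d) :
    Measurable fun w : Input d => (inner ℝ x x' : ℝ) * (act w x * act w x') :=
  ((measurable_act x).mul (measurable_act x')).const_mul _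

theorem abs_gramInf_le {x : Fin n → Input d} {x' : Fin n' → Input d} (hx : ∀ i, ‖x i‖ = 1)
    (hx' : ∀ i, ‖x' i‖ = 1) (i : Fin n) (j : Fin n') : |gramInf x x' i j| ≤ 1 := by
  rw [gramInf_apply]
  have h := norm_integral_le_of_norm_le_const (C := 1) (μ := stdGaussian (Input d))
    (f := fun w => inner ℝ (x i) (x' j) * (act w (x i) * act w (x' j)))
    (.of_forall fun w => abs_gram_integrand_le (hx i) (hx' j) w)
  simpa using h

theorem isHermitian_gramInf (x : Fin n → Input d) : (gramInf x x).IsHermitian := by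
  ext i j
  rw [conjTranspose_apply, star_trivial, gramInf_apply, gramInf_apply]
  congr 1
  ext w
  rw [real_inner_comm]
  ring

/-- The average of the Gram matrix at initialization is the limiting Gram matrix. -/
theorem integral_gram_weightLaw (hκ : 0 < κ) (x : Fin n → Input d) (x' : Fin n' → Input d)
    (i : Fin n) (j : Fin n') :
    ∫ w, inner ℝ (x i) (x' j) * (act w (x i) * act w (x' j)) ∂(weightLaw d κ) =
      gramInf x x' i j := by
  rw [gramInf_apply, weightLaw_eq_map hκ, integral_map (by fun_prop)
    (measurable_gram_integrand _ _).aestronglyMeasurable]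
  simp only [act_smul hκ]

/-- With high probability the network output at initialization is of order `κ`. -/
theorem initLaw_network_sq_le (hm : 0 < m) (hκ : 0 < κ) {x : Fin n → Input d} (hn : 0 < n)
    (hx : ∀ i, ‖x i‖ = 1) {δ : ℝ} (hδ : 0 < δ) :
    (initLaw d m κ).real {ω | n * κ ^ 2 / δ ≤ ∑ i, network ω.2 ω.1 (x i) ^ 2} ≤ δ := by
  have hone : ∀ i, Integrable (fun ω : Weights d m × (Fin m → ℝ) => network ω.2 ω.1 (x i) ^ 2)
      (initLaw d m κ) ∧ ∫ ω, network ω.2 ω.1 (x i) ^ 2 ∂(initLaw d m κ) ≤ κ ^ 2 := by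
    intro i
    set f : Input d × ℝ → ℝ := fun p => 1 / √(m : ℝ) * (p.2 * relu (inner ℝ p.1 (x i))) with hf
    have hg : MemLp (fun p : Input d × ℝ => 1 / √(m : ℝ) * (inner ℝ p.1 (x i) : ℝ)) 2
        (unitLaw d κ) :=
      ((integrable_weightLaw_sq (x i)).const_mul _).comp_measurePreserving measurePreserving_fst
    have hrelu : Measurable relu := measurable_id.max measurable_const
    have hfm : Measurable f := by
      refine (measurable_snd.mul (hrelu.comp ?_)).const_mul _
      fun_prop
    have hle : ∀ᵐ p ∂(unitLaw d κ), |f p| ≤ |1 / √(m : ℝ) * (inner ℝ p.1 (x i) : ℝ)| := by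
      have : ∀ᵐ p ∂(unitLaw d κ), p.2 = -1 ∨ p.2 = 1 :=
        Measure.quasiMeasurePreserving_snd.ae signLaw_ae
      filter_upwards [this] with p hp
      have h1 : |p.2| = 1 := by rcases hp with h | h <;> simp [h]
      simp only [hf]
      rw [abs_mul, abs_mul p.2, h1, one_mul, abs_mul]
      refine mul_le_mul_of_nonneg_left ?_ (abs_nonneg _)
      rw [relu, abs_of_nonneg (le_max_right _ _)]
      exact max_le (le_abs_self _) (abs_nonneg _)
    have hf2 : MemLp f 2 (unitLaw d κ) := hg.mono hfm.aestronglyMeasurable hle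
    -- The sign is independent of the input weight and centred, so the mean square deviation is the
    -- plain second moment.
    have hf0 : ∫ p, f p ∂(unitLaw d κ) = 0 := by
      have h1 : f = fun p => (1 / √(m : ℝ) * relu (inner ℝ p.1 (x i))) * p.2 := by
        ext p; simp only [hf]; ring
      rw [h1, integral_prod_mul (fun w : Input d => 1 / √(m : ℝ) * relu (inner ℝ w (x i)))
        (fun a : ℝ => a), integral_signLaw, mul_zero]
    have hf3 : ∫ p, f p ^ 2 ∂(unitLaw d κ) ≤ 1 / m * κ ^ 2 := by
      calc ∫ p, f p ^ 2 ∂(unitLaw d κ)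
          ≤ ∫ p, (1 / √(m : ℝ) * (inner ℝ p.1 (x i) : ℝ)) ^ 2 ∂(unitLaw d κ) := by
            refine integral_mono_ae hf2.integrable_sq hg.integrable_sq ?_
            filter_upwards [hle] with p hp
            exact sq_le_sq.2 hp
        _ = ∫ w, (1 / √(m : ℝ) * (inner ℝ w (x i) : ℝ)) ^ 2 ∂(weightLaw d κ) := by
            rw [integral_fun_fst (μ := weightLaw d κ) (ν := signLaw)
              (fun w => (1 / √(m : ℝ) * (inner ℝ w (x i) : ℝ)) ^ 2)]
            simp
        _ = _ := by
            simp only [mul_pow, div_pow, Real.sq_sqrt (Nat.cast_nonneg (α := ℝ) m)]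
            rw [integral_const_mul, integral_inner_sq (hx i), one_pow]
    have h := integral_sum_units_sub_sq (m := m) hf2
    rw [hf0] at h
    simp only [mul_zero, sub_zero, hf, ← Finset.mul_sum] at h
    refine ⟨h.1, h.2.trans ?_⟩
    have : (m : ℝ) * (1 / m * κ ^ 2) = κ ^ 2 := by field_simp
    rw [← this]
    exact mul_le_mul_of_nonneg_left hf3 (Nat.cast_nonneg m)
  refine markov_real (B := n * κ ^ 2) (fun ω => Finset.sum_nonneg fun i _ => sq_nonneg _)
    (integrable_finsetSum _ fun i _ => (hone i).1) ?_ (by positivity) (by field_simp; rfl)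
  rw [integral_finsetSum _ fun i _ => (hone i).1]
  refine (Finset.sum_le_sum fun i _ => (hone i).2).trans (by simp)

/-- With high probability the Gram matrix at initialization is close to its limit. -/
theorem initLaw_gram_sub_sq_le (hm : 0 < m) (hκ : 0 < κ) {x : Fin n → Input d}
    {x' : Fin n' → Input d} (hn : 0 < n) (hn' : 0 < n')
    (hx : ∀ i, ‖x i‖ = 1) (hx' : ∀ i, ‖x' i‖ = 1) {δ : ℝ} (hδ : 0 < δ) :
    (initLaw d m κ).real {ω | n * n' / (m * δ) ≤ ∑ i, ∑ j,
      (∑ r, 1 / (m : ℝ) * (inner ℝ (x i) (x' j) * (act (ω.1 r) (x i) * act (ω.1 r) (x' j))) -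
        gramInf x x' i j) ^ 2} ≤ δ := by
  have hone : ∀ i j, Integrable (fun ω : Weights d m × (Fin m → ℝ) =>
      (∑ r, 1 / (m : ℝ) * (inner ℝ (x i) (x' j) * (act (ω.1 r) (x i) * act (ω.1 r) (x' j))) -
        gramInf x x' i j) ^ 2) (initLaw d m κ) ∧
      ∫ ω, (∑ r, 1 / (m : ℝ) *
        (inner ℝ (x i) (x' j) * (act (ω.1 r) (x i) * act (ω.1 r) (x' j))) -
        gramInf x x' i j) ^ 2 ∂(initLaw d m κ) ≤ 1 / m := by
    intro i j
    set g : Input d → ℝ := fun w =>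
      1 / (m : ℝ) * (inner ℝ (x i) (x' j) * (act w (x i) * act w (x' j))) with hg
    have hgm : Measurable g := (measurable_gram_integrand _ _).const_mul _
    have hgle : ∀ w, |g w| ≤ 1 / m := by
      intro w
      simp only [hg]
      rw [abs_mul, abs_of_nonneg (by positivity : (0 : ℝ) ≤ 1 / m)]
      exact mul_le_of_le_one_right (by positivity) (abs_gram_integrand_le (hx i) (hx' j) w)
    have hf2 : MemLp (fun p : Input d × ℝ => g p.1) 2 (unitLaw d κ) :=
      MemLp.of_bound (hgm.comp measurable_fst).aestronglyMeasurable _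
        (.of_forall fun p => hgle p.1)
    have hf0 : m * ∫ p : Input d × ℝ, g p.1 ∂(unitLaw d κ) = gramInf x x' i j := by
      rw [integral_fun_fst (μ := weightLaw d κ) (ν := signLaw) g]
      simp only [hg, integral_const_mul, integral_gram_weightLaw hκ]
      simp only [probReal_univ, one_smul]
      field_simp
    have hf3 : ∫ p : Input d × ℝ, g p.1 ^ 2 ∂(unitLaw d κ) ≤ (1 / m) ^ 2 := by
      calc ∫ p : Input d × ℝ, g p.1 ^ 2 ∂(unitLaw d κ)
          ≤ ∫ _p : Input d × ℝ, (1 / (m : ℝ)) ^ 2 ∂(unitLaw d κ) := by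
            refine integral_mono hf2.integrable_sq (integrable_const _) fun p => ?_
            rw [← sq_abs]
            exact pow_le_pow_left₀ (abs_nonneg _) (hgle p.1) 2
        _ = _ := by simp
    have h := integral_sum_units_sub_sq (m := m) hf2
    rw [hf0] at h
    refine ⟨h.1, h.2.trans ?_⟩
    calc (m : ℝ) * ∫ p : Input d × ℝ, g p.1 ^ 2 ∂(unitLaw d κ) ≤ m * (1 / m) ^ 2 := by gcongr
      _ = _ := by field_simp
  refine markov_real (B := n * n' / m)
    (fun ω => Finset.sum_nonneg fun i _ => Finset.sum_nonneg fun j _ => sq_nonneg _)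
    (integrable_finsetSum _ fun i _ => integrable_finsetSum _ fun j _ => (hone i j).1) ?_
    (by positivity) (by field_simp; rfl)
  rw [integral_finsetSum _ fun i _ => integrable_finsetSum _ fun j _ => (hone i j).1]
  calc _ ≤ ∑ _i : Fin n, ∑ _j : Fin n', 1 / (m : ℝ) := by
        refine Finset.sum_le_sum fun i _ => ?_
        rw [integral_finsetSum _ fun j _ => (hone i j).1]
        exact Finset.sum_le_sum fun j _ => (hone i j).2
    _ = _ := by simp; ring

/-- With high probability few hidden units are close to the kink of the activation. -/
theorem initLaw_nearFrac_le (hm : 0 < m) (hκ : 0 < κ) {x : Fin n → Input d} (hn : 0 < n)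
    (hx : ∀ i, ‖x i‖ = 1) {R δ : ℝ} (hR : 0 < R) (hδ : 0 < δ) :
    (initLaw d m κ).real {ω | n * R / (κ * δ) ≤ ∑ i, nearFrac ω.1 R (x i)} ≤ δ := by
  have hone : ∀ i, Integrable (fun ω : Weights d m × (Fin m → ℝ) => nearFrac ω.1 R (x i))
      (initLaw d m κ) ∧ ∫ ω, nearFrac ω.1 R (x i) ∂(initLaw d m κ) ≤ R / κ := by
    intro i
    set s : Set (Input d) := (fun w => (inner ℝ w (x i) : ℝ)) ⁻¹' Set.Icc (-R) R with hs
    have hsm : MeasurableSet s := measurableSet_preimage (by fun_prop) measurableSet_Icc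
    set g : Input d → ℝ := s.indicator 1 with hg
    have hgeq : ∀ w, (if |(inner ℝ w (x i) : ℝ)| ≤ R then (1 : ℝ) else 0) = g w := by
      intro w
      have hmem : w ∈ s ↔ |(inner ℝ w (x i) : ℝ)| ≤ R := by
        rw [hs, Set.mem_preimage, Set.mem_Icc, abs_le]
      by_cases hw : |(inner ℝ w (x i) : ℝ)| ≤ R
      · rw [if_pos hw, hg, Set.indicator_of_mem (hmem.2 hw), Pi.one_apply]
      · rw [if_neg hw, hg, Set.indicator_of_notMem fun h => hw (hmem.1 h)]
    have hgint : Integrable g (weightLaw d κ) := (integrable_const 1).indicator hsm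
    have hfint : Integrable (fun p : Input d × ℝ => g p.1) (unitLaw d κ) :=
      hgint.comp_fst signLaw
    have hf0 : ∫ p : Input d × ℝ, g p.1 ∂(unitLaw d κ) ≤ R / κ := by
      rw [integral_fun_fst (μ := weightLaw d κ) (ν := signLaw) g, hg, integral_indicator_one hsm,
        hs, ← map_measureReal_apply (by fun_prop) measurableSet_Icc, weightLaw_map_inner (hx i)]
      simpa using gaussianReal_Icc_le hκ hR.le
    have h := integral_sum_units (m := m) hfint
    simp only [nearFrac, hgeq]
    refine ⟨h.1.div_const _, ?_⟩
    rw [integral_div, h.2, mul_div_cancel_left₀ _ (by positivity)]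
    exact hf0
  refine markov_real (B := n * (R / κ)) (fun ω => Finset.sum_nonneg fun i _ => nearFrac_nonneg _ _ _)
    (integrable_finsetSum _ fun i _ => (hone i).1) ?_ (by positivity) (by field_simp; rfl)
  rw [integral_finsetSum _ fun i _ => (hone i).1]
  refine (Finset.sum_le_sum fun i _ => (hone i).2).trans (by simp)

end Probability

/-! ### Spectral facts, polynomial bookkeeping and the size of the remaining errors. -/

section Main

variable {d m n n' : ℕ}

/-- Inner products of features form the Gram matrix at initialization. -/
theorem inner_feat_feat {a : Fin m → ℝ} (ha : ∀ r, |a r| = 1) (W : Weights d m)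
    (x x' : Input d) : (inner ℝ (feat a W x) (feat a W x') : ℝ) =
      ∑ r, 1 / (m : ℝ) * (inner ℝ x x' * (act (W r) x * act (W r) x')) := by
  rw [inner_feat]
  refine Finset.sum_congr rfl fun r _ => ?_
  have h1 : feat a W x' r = (1 / √(m : ℝ) * a r * act (W r) x') • x' := rfl
  have h2 : 1 / √(m : ℝ) * (1 / √(m : ℝ)) = 1 / m := by
    rw [div_mul_div_comm, one_mul, Real.mul_self_sqrt (Nat.cast_nonneg _)]
  have h3 : a r * a r = 1 := by rw [← abs_mul_abs_self, ha r, one_mul]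
  rw [h1, real_inner_smul_left, real_inner_comm x x', ← h2]
  calc _ = 1 / √(m : ℝ) * (1 / √(m : ℝ)) * (a r * a r) *
        (inner ℝ x x' * (act (W r) x * act (W r) x')) := by ring
    _ = _ := by rw [h3]; ring

/-- Matrices of size zero form a trivial ring, in which the spectrum is empty; a least eigenvalue
therefore excludes empty data sets. -/
theorem pos_of_isLeast_spectrum {M : Matrix (Fin n) (Fin n) ℝ} {lam : ℝ}
    (h : IsLeast (spectrum ℝ M) lam) : 0 < n := by
  rcases Nat.eq_zero_or_pos n with rfl | hn
  · have := h.1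
    rw [spectrum.of_subsingleton] at this
    exact this.elim
  · exact hn

theorem mul_inv_of_isLeast_spectrum {M : Matrix (Fin n) (Fin n) ℝ} {lam : ℝ}
    (h : IsLeast (spectrum ℝ M) lam) (hlam : 0 < lam) : M * M⁻¹ = 1 := by
  refine mul_nonsing_inv _ ((isUnit_iff_isUnit_det _).1 ?_)
  rw [← spectrum.zero_notMem_iff ℝ]
  exact fun h0 => (h.2 h0).not_gt hlam

theorem Coercive.lam_le_one {M : Matrix (Fin n) (Fin n) ℝ} {lam L : ℝ} (hn : 0 < n)
    (h : Coercive (toEuclideanCLM (𝕜 := ℝ) M) lam L) (hM : ∀ i j, |M i j| ≤ 1) : lam ≤ 1 := by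
  have h1 := h.lower (EuclideanSpace.single ⟨0, hn⟩ 1)
  rw [real_inner_comm, inner_toEuclideanCLM] at h1
  simp at h1
  exact h1.trans ((le_abs_self _).trans (hM _ _))

theorem polyBound_pow (p : MvPolynomial (Fin 6) ℝ) (k nP nQ : ℕ) (δ lamP lamQ κ : ℝ) :
    polyBound (p ^ k) nP nQ δ lamP lamQ κ = polyBound p nP nQ δ lamP lamQ κ ^ k := by
  simp [polyBound]

theorem polyBound_sum (c : ℝ) (nP nQ : ℕ) (δ lamP lamQ κ : ℝ) :
    polyBound (∑ i, MvPolynomial.X i + MvPolynomial.C c) nP nQ δ lamP lamQ κ =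
      nP + nQ + δ⁻¹ + lamP⁻¹ + lamQ⁻¹ + κ⁻¹ + c := by
  simp [polyBound, Fin.sum_univ_six]

theorem norm_residual_zero_sq (a : Fin m → ℝ) (x : Fin n → Input d) (W : Weights d m) :
    ‖residual a x 0 W‖ ^ 2 = ∑ i, network a W (x i) ^ 2 := by
  rw [EuclideanSpace.real_norm_sq_eq]
  simp [residual]

theorem abs_le_of_sum_sq_lt {f : Fin n → Fin n' → ℝ} {t γ : ℝ} (hγ : 0 ≤ γ) (ht : t ≤ γ ^ 2)
    (h : ∑ i, ∑ j, f i j ^ 2 < t) (i : Fin n) (j : Fin n') : |f i j| ≤ γ := by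
  refine abs_le_of_sq_le_sq ?_ hγ
  refine le_trans ?_ (h.le.trans ht)
  calc f i j ^ 2 ≤ ∑ j, f i j ^ 2 :=
        Finset.single_le_sum (f := fun j => f i j ^ 2) (fun j _ => sq_nonneg _) (Finset.mem_univ j)
    _ ≤ _ := Finset.single_le_sum (f := fun i => ∑ j, f i j ^ 2)
        (fun i _ => Finset.sum_nonneg fun j _ => sq_nonneg _) (Finset.mem_univ i)

/-- From `1 - t ≤ exp (-t)`: at rate `ηλ/4`, `log m / (ηλ)` steps bring the residual down to exactly
the `m^{-1/4}` of the linearization error. -/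
theorem pow_le_inv_rpow {m : ℕ} (hm : 0 < m) {η lam : ℝ} (hη : 0 < η) (hlam : 0 < lam)
    (h1 : η * lam ≤ 1) {K : ℕ} (hK : Real.log (m : ℝ) / (η * lam) ≤ K) :
    (1 - η * lam / 4) ^ K ≤ 1 / (m : ℝ) ^ (1 / 4 : ℝ) := by
  have hm' : (0 : ℝ) < m := by exact_mod_cast hm
  have h2 : 1 - η * lam / 4 ≤ Real.exp (-(η * lam / 4)) := by
    have := Real.add_one_le_exp (-(η * lam / 4))
    linarith
  rw [div_le_iff₀ (by positivity)] at hK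
  calc (1 - η * lam / 4) ^ K ≤ Real.exp (-(η * lam / 4)) ^ K :=
        pow_le_pow_left₀ (by linarith) h2 K
    _ = Real.exp (-(K * (η * lam) / 4)) := by rw [← Real.exp_nat_mul]; ring_nf
    _ ≤ Real.exp (-(Real.log m * (1 / 4))) := by gcongr; linarith
    _ = _ := by rw [Real.exp_neg, Real.rpow_def_of_pos hm', one_div (Real.exp _)]

/-- The influence of the network output at initialization. -/
theorem init_error_le {nP nQ : ℕ} (hnP : 0 < nP) {cκ κ δ lamP lamQ UP UQ : ℝ}
    (hκ : 0 < κ) (hκc : κ ≤ cκ) (hδ : 0 < δ) (hlamP : 0 < lamP) (hlamP1 : lamP ≤ 1)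
    (hlamQ : 0 < lamQ) (hUP : UP = √(nP * κ ^ 2 / (δ / 7))) (hUQ : UQ = √(nQ * κ ^ 2 / (δ / 7))) :
    (UQ + √(nQ : ℝ) * √(nP : ℝ) * (UP / lamP)) / lamQ ≤
      2 * √(7 * cκ) * ((nP : ℝ) * √(nQ : ℝ) * √κ / (lamP * lamQ * √δ)) := by
  have hU : ∀ n : ℕ, √(n * κ ^ 2 / (δ / 7)) = √7 * κ * √(n : ℝ) / √δ := by
    intro n
    rw [show n * κ ^ 2 / (δ / 7) = 7 * κ ^ 2 * n / δ by field_simp, Real.sqrt_div' _ hδ.le,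
      Real.sqrt_mul (by positivity), Real.sqrt_mul (by norm_num), Real.sqrt_sq hκ.le]
  have hsδ : 0 < √δ := Real.sqrt_pos.2 hδ
  have hnP1 : (1 : ℝ) ≤ nP := by exact_mod_cast hnP
  have hone : 1 ≤ nP / lamP := by rw [one_le_div hlamP]; linarith
  -- One half power of `κ` is traded for `√cκ`, which becomes part of the constant `C`.
  have hκs : κ ≤ √cκ * √κ := by
    calc κ = √κ * √κ := (Real.mul_self_sqrt hκ.le).symm
      _ ≤ _ := by gcongr
  rw [hUP, hUQ, hU, hU]
  calc (√7 * κ * √(nQ : ℝ) / √δ + √(nQ : ℝ) * √(nP : ℝ) * (√7 * κ * √(nP : ℝ) / √δ / lamP)) / lamQ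
      = √7 * √(nQ : ℝ) / √δ * (1 + (√(nP : ℝ) * √(nP : ℝ)) / lamP) / lamQ * κ := by field_simp
    _ ≤ √7 * √(nQ : ℝ) / √δ * (nP / lamP + nP / lamP) / lamQ * (√cκ * √κ) := by
        rw [Real.mul_self_sqrt (Nat.cast_nonneg _)]
        gcongr
    _ = _ := by
        rw [Real.sqrt_mul (by norm_num : (0 : ℝ) ≤ 7)]
        field_simp
        ring

end Main

end TransferReLU

end

/-! ### The theorem: choice of constants and union bound. -/

open TransferReLU

set_option maxHeartbeats 1000000 in
theorem theorem2 :
    ∃ cη : ℝ, 0 < cη ∧ ∀ cκ : ℝ, 0 < cκ →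
    ∃ (C : ℝ) (p₁ p₂ : MvPolynomial (Fin 6) ℝ), 0 < C ∧
    ∀ (d m nP nQ : ℕ)
      (xP : Fin nP → Input d) (yP : Fin nP → ℝ) (xQ : Fin nQ → Input d) (yQ : Fin nQ → ℝ)
      (lamP lamQ δ κ η : ℝ),
      (∀ i, ‖xP i‖ = 1) → (∀ i, |yP i| ≤ 1) → (∀ i, ‖xQ i‖ = 1) → (∀ i, |yQ i| ≤ 1) →
      IsLeast (spectrum ℝ (gramInf xP xP)) lamP → 0 < lamP →
      IsLeast (spectrum ℝ (gramInf xQ xQ)) lamQ → 0 < lamQ →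
      0 < δ → δ < 1 →
      0 < κ → κ ≤ cκ * (lamP ^ 2 * lamQ ^ 2 * δ / ((nP : ℝ) ^ 2 * √(nQ : ℝ))) →
      0 < η → η ≤ cη * (lamP / (nP : ℝ) ^ 2) → η ≤ cη * (lamQ / (nQ : ℝ) ^ 2) →
      polyBound p₁ nP nQ δ lamP lamQ κ ≤ (m : ℝ) →
      1 - δ ≤ (initLaw d m κ).real
        {ω | ∀ KP KQ : ℕ, Real.log (m : ℝ) / (η * lamP) ≤ (KP : ℝ) →
          let WP : Weights d m := gradDescent ω.2 xP yP η ω.1 KP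
          let WQ : Weights d m := gradDescent ω.2 xQ yQ η WP KQ
          frobNorm (WQ - WP) ≤
            √((yQ - transferredLabel xP yP xQ) ⬝ᵥ
                ((gramInf xQ xQ)⁻¹ *ᵥ (yQ - transferredLabel xP yP xQ)))
              + C * ((nP : ℝ) * √(nQ : ℝ) * √κ / (lamP * lamQ * √δ))
              + polyBound p₂ nP nQ δ lamP lamQ κ / (m : ℝ) ^ (1 / 4 : ℝ)} := by
  -- In `C`, the 7 counts the bad events of probability `δ/7`, `√cκ` comes from `κ ≤ √cκ √κ`, and 2
  -- from bounding `1` and `nP / lamP` both by `nP / lamP`. With `τ = X ^ 9 / m^{1/4}`, the exponent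
  -- `56 = 4 * 14` ensures `X ^ 5 * τ ≤ 1`, and `27 = 18 + 9` comes from the error `X ^ 18 * τ`.
  refine ⟨1, one_pos, fun cκ hcκ => ⟨2 * √(7 * cκ),
    (∑ i, MvPolynomial.X i + MvPolynomial.C (cκ + 10)) ^ 56,
    (∑ i, MvPolynomial.X i + MvPolynomial.C (cκ + 10)) ^ 27, by positivity, ?_⟩⟩
  intro d m nP nQ xP yP xQ yQ lamP lamQ δ κ η hxP hyP hxQ hyQ hlP hlamP hlQ hlamQ hδ hδ1 hκ hκle
    hη hηP hηQ hm
  rw [one_mul] at hηP hηQ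
  rw [polyBound_pow, polyBound_sum] at hm
  rw [polyBound_pow, polyBound_sum]
  have hnP := pos_of_isLeast_spectrum hlP
  have hnQ := pos_of_isLeast_spectrum hlQ
  have hHP := coercive_toEuclideanCLM (isHermitian_gramInf xP) (abs_gramInf_le hxP hxP) hlP
  have hHQ := coercive_toEuclideanCLM (isHermitian_gramInf xQ) (abs_gramInf_le hxQ hxQ) hlQ
  have hlamP1 := hHP.lam_le_one hnP (abs_gramInf_le hxP hxP)
  have hlamQ1 := hHQ.lam_le_one hnQ (abs_gramInf_le hxQ hxQ)
  have hnP1 : (1 : ℝ) ≤ nP := by exact_mod_cast hnP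
  have hnQ1 : (1 : ℝ) ≤ nQ := by exact_mod_cast hnQ
  have hδi : 0 < δ⁻¹ := by positivity
  have hlPi : 0 < lamP⁻¹ := by positivity
  have hlQi : 0 < lamQ⁻¹ := by positivity
  have hκi : 0 < κ⁻¹ := by positivity
  have hκc : κ ≤ cκ := by
    refine hκle.trans (mul_le_of_le_one_right hcκ.le ?_)
    have h1 : 1 ≤ (nP : ℝ) ^ 2 * √(nQ : ℝ) :=
      one_le_mul_of_one_le_of_one_le (one_le_pow₀ hnP1) (Real.one_le_sqrt.2 hnQ1)
    refine div_le_one_of_le₀ (le_trans ?_ h1) (by positivity)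
    have h2 : lamP ^ 2 ≤ 1 := pow_le_one₀ hlamP.le hlamP1
    have h3 : lamQ ^ 2 ≤ 1 := pow_le_one₀ hlamQ.le hlamQ1
    exact mul_le_one₀ (mul_le_one₀ h2 (sq_nonneg _) h3) hδ.le hδ1.le
  obtain ⟨X, hX⟩ : ∃ X : ℝ, (nP : ℝ) + nQ + δ⁻¹ + lamP⁻¹ + lamQ⁻¹ + κ⁻¹ + (cκ + 10) = X := ⟨_, rfl⟩
  rw [hX] at hm ⊢
  have hX10 : 10 ≤ X := by linarith
  have hXP : (nP : ℝ) ≤ X := by linarith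
  have hXQ : (nQ : ℝ) ≤ X := by linarith
  have hXδ : δ⁻¹ ≤ X := by linarith
  have hXlP : lamP⁻¹ ≤ X := by linarith
  have hXlQ : lamQ⁻¹ ≤ X := by linarith
  have hXκi : κ⁻¹ ≤ X := by linarith
  have hXκ : κ ≤ X := by linarith
  clear hX
  have hX0 : 0 < X := by linarith
  have hX1 : 1 ≤ X := by linarith
  have hm0 : 0 < m := by
    have : (0 : ℝ) < m := lt_of_lt_of_le (by positivity) hm
    exact_mod_cast this
  have hmr : (0 : ℝ) < m := by exact_mod_cast hm0
  obtain ⟨q, hq⟩ : ∃ q, (m : ℝ) ^ (1 / 4 : ℝ) = q := ⟨_, rfl⟩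
  have hq0 : 0 < q := by rw [← hq]; positivity
  have hq4 : q ^ 4 = m := by
    rw [← hq, ← Real.rpow_natCast, ← Real.rpow_mul hmr.le]
    norm_num
  have hqs : √(m : ℝ) = q ^ 2 := by
    rw [← hq4, show q ^ 4 = (q ^ 2) ^ 2 by ring, Real.sqrt_sq (by positivity)]
  have hqX : X ^ 14 ≤ q := by
    refine le_of_pow_le_pow_left₀ (by norm_num : 4 ≠ 0) hq0.le ?_
    rw [hq4, ← pow_mul]
    exact hm
  rw [hq]
  set R := X ^ 14 / √(m : ℝ) with hR
  have hR0 : 0 < R := by positivity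
  -- This fixes `τ`: four factors `X` for `7 * n`, `κ⁻¹` and `δ⁻¹` with room to spare, times `X ^ 14
  -- / q ^ 2`, make the square of `X ^ 9 / q`.
  have hnear : ∀ n : ℕ, (n : ℝ) ≤ X → n * R / (κ * (δ / 7)) ≤ (X ^ 9 / q) ^ 2 := by
    intro n hn
    calc n * R / (κ * (δ / 7)) = 7 * n * κ⁻¹ * δ⁻¹ * (X ^ 14 / q ^ 2) := by
          rw [hR, hqs]; field_simp
      _ ≤ X * X * X * X * (X ^ 14 / q ^ 2) := by gcongr; linarith
      _ = _ := by ring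
  have hgram : ∀ n n' : ℕ, (n : ℝ) ≤ X → (n' : ℝ) ≤ X →
      n * n' / (m * (δ / 7)) ≤ (X ^ 2 / q ^ 2) ^ 2 := by
    intro n n' hn hn'
    calc n * n' / (m * (δ / 7)) = 7 * n * n' * δ⁻¹ * (1 / q ^ 4) := by
          rw [hq4]; field_simp
      _ ≤ X * X * X * X * (1 / q ^ 4) := by gcongr; linarith
      _ = _ := by ring
  have hnet : ∀ n : ℕ, (n : ℝ) ≤ X → √(n * κ ^ 2 / (δ / 7)) ≤ X ^ 4 := by
    intro n hn
    refine Real.sqrt_le_iff.2 ⟨by positivity, ?_⟩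
    calc n * κ ^ 2 / (δ / 7) = 7 * n * κ ^ 2 * δ⁻¹ := by field_simp
      _ ≤ X * X * X ^ 2 * X := by gcongr; linarith
      _ = X ^ 5 := by ring
      _ ≤ X ^ 8 := pow_le_pow_right₀ hX1 (by norm_num)
      _ = _ := by ring
  have hδ7 : 0 < δ / 7 := by positivity
  have e1 := initLaw_network_sq_le hm0 hκ hnP hxP hδ7
  have e2 := initLaw_network_sq_le hm0 hκ hnQ hxQ hδ7
  have e3 := initLaw_gram_sub_sq_le hm0 hκ hnP hnP hxP hxP hδ7
  have e4 := initLaw_gram_sub_sq_le hm0 hκ hnQ hnQ hxQ hxQ hδ7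
  have e5 := initLaw_gram_sub_sq_le hm0 hκ hnP hnQ hxP hxQ hδ7
  have e6 := initLaw_nearFrac_le hm0 hκ hnP hxP hR0 hδ7
  have e7 := initLaw_nearFrac_le hm0 hκ hnQ hxQ hR0 hδ7
  have e0 : (initLaw d m κ).real {ω | ¬ ∀ r, |ω.2 r| = 1} = 0 := by
    rw [measureReal_def, show initLaw d m κ {ω | ¬ ∀ r, |ω.2 r| = 1} = 0 from initLaw_ae]
    rfl
  generalize hA1 : {ω : Weights d m × (Fin m → ℝ) | _} = A1 at e1
  generalize hA2 : {ω : Weights d m × (Fin m → ℝ) | _} = A2 at e2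
  generalize hA3 : {ω : Weights d m × (Fin m → ℝ) | _} = A3 at e3
  generalize hA4 : {ω : Weights d m × (Fin m → ℝ) | _} = A4 at e4
  generalize hA5 : {ω : Weights d m × (Fin m → ℝ) | _} = A5 at e5
  generalize hA6 : {ω : Weights d m × (Fin m → ℝ) | _} = A6 at e6
  generalize hA7 : {ω : Weights d m × (Fin m → ℝ) | _} = A7 at e7
  generalize hA0 : {ω : Weights d m × (Fin m → ℝ) | _} = A0 at e0
  set G : Set (Weights d m × (Fin m → ℝ)) := {ω | _} with hG
  -- Covering the whole space, instead of passing to complements, uses only subadditivity, so no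
  -- measurability of `G` is needed.
  suffices hcover : (Set.univ : Set (Weights d m × (Fin m → ℝ))) ⊆
      G ∪ A0 ∪ A1 ∪ A2 ∪ A3 ∪ A4 ∪ A5 ∪ A6 ∪ A7 by
    have h1 := measureReal_mono (μ := initLaw d m κ) hcover
    rw [probReal_univ] at h1
    have u7 := measureReal_union_le (μ := initLaw d m κ)
      (G ∪ A0 ∪ A1 ∪ A2 ∪ A3 ∪ A4 ∪ A5 ∪ A6) A7
    have u6 := measureReal_union_le (μ := initLaw d m κ) (G ∪ A0 ∪ A1 ∪ A2 ∪ A3 ∪ A4 ∪ A5) A6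
    have u5 := measureReal_union_le (μ := initLaw d m κ) (G ∪ A0 ∪ A1 ∪ A2 ∪ A3 ∪ A4) A5
    have u4 := measureReal_union_le (μ := initLaw d m κ) (G ∪ A0 ∪ A1 ∪ A2 ∪ A3) A4
    have u3 := measureReal_union_le (μ := initLaw d m κ) (G ∪ A0 ∪ A1 ∪ A2) A3
    have u2 := measureReal_union_le (μ := initLaw d m κ) (G ∪ A0 ∪ A1) A2
    have u1 := measureReal_union_le (μ := initLaw d m κ) (G ∪ A0) A1
    have u0 := measureReal_union_le (μ := initLaw d m κ) G A0
    linarith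
  rintro ω -
  by_contra hω
  simp only [Set.mem_union, not_or] at hω
  obtain ⟨⟨⟨⟨⟨⟨⟨⟨hωG, h0⟩, h1⟩, h2⟩, h3⟩, h4⟩, h5⟩, h6⟩, h7⟩ := hω
  rw [← hA0, Set.mem_ofPred_eq, not_not] at h0
  rw [← hA1, Set.mem_ofPred_eq, not_le] at h1
  rw [← hA2, Set.mem_ofPred_eq, not_le] at h2
  rw [← hA3, Set.mem_ofPred_eq, not_le] at h3
  rw [← hA4, Set.mem_ofPred_eq, not_le] at h4
  rw [← hA5, Set.mem_ofPred_eq, not_le] at h5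
  rw [← hA6, Set.mem_ofPred_eq, not_le] at h6
  rw [← hA7, Set.mem_ofPred_eq, not_le] at h7
  -- The step counts are introduced only after the good initialization is fixed, which yields the
  -- bound simultaneously for all of them.
  refine hωG fun KP KQ hK => ?_
  have hηP3 : η * lamP ≤ 1 := by
    have h8 : η ≤ 1 := hηP.trans (div_le_one_of_le₀ (hlamP1.trans (one_le_pow₀ hnP1))
      (by positivity))
    exact mul_le_one₀ h8 hlamP.le hlamP1
  have hKτ : (1 - η * lamP / 4) ^ KP ≤ X ^ 9 / q := by
    refine (pow_le_inv_rpow hm0 hη hlamP hηP3 hK).trans ?_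
    rw [hq]
    gcongr
    exact one_le_pow₀ hX1
  have hsum : ∀ {n : ℕ} {x : Fin n → Input d}, (n : ℝ) ≤ X →
      ∑ i, nearFrac ω.1 R (x i) < n * R / (κ * (δ / 7)) →
      ∀ i, nearFrac ω.1 R (x i) ≤ (X ^ 9 / q) ^ 2 := by
    intro n x hn h i
    exact (Finset.single_le_sum (f := fun i => nearFrac ω.1 R (x i))
      (fun i _ => nearFrac_nonneg _ _ _) (Finset.mem_univ i)).trans (h.le.trans (hnear n hn))
  have hγ0 : 0 ≤ X ^ 2 / q ^ 2 := by positivity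
  have hmain := frobNorm_transfer_le (a := ω.2) (W₀ := ω.1) (xP := xP) (xQ := xQ) (yP := yP)
    (yQ := yQ) (HPQ := gramInf xP xQ) (R := R) (τ := X ^ 9 / q) (γ := X ^ 2 / q ^ 2) (X := X)
    hHP (mul_inv_of_isLeast_spectrum hlP hlamP) hHQ (mul_inv_of_isLeast_spectrum hlQ hlamQ)
    (abs_gramInf_le hxP hxQ) hm0 hnP hnQ h0 hxP hyP hxQ hyQ hη hlamP hlamP1 hlamQ hlamQ1 hηP hηQ
    (by positivity) hX10
    (by rw [mul_div_assoc', div_le_one hq0, ← pow_add]; exact hqX)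
    hXP hXQ hXlP hXlQ
    (by
      rw [mul_div_assoc', div_pow, ← pow_add, ← pow_mul]
      gcongr 1
      exact pow_le_pow_right₀ hX1 (by norm_num))
    hR (hsum hXP h6) (hsum hXQ h7)
    (by
      intro i j
      rw [inner_feat_feat h0]
      exact abs_le_of_sum_sq_lt hγ0 (hgram _ _ hXP hXP) h3 i j)
    (by
      intro i j
      rw [inner_feat_feat h0]
      exact abs_le_of_sum_sq_lt hγ0 (hgram _ _ hXQ hXQ) h4 i j)
    (by
      intro i j
      rw [inner_feat_feat h0]
      exact abs_le_of_sum_sq_lt hγ0 (hgram _ _ hXP hXQ) h5 i j)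
    (Real.le_sqrt_of_sq_le (by rw [norm_residual_zero_sq]; exact h1.le))
    (Real.le_sqrt_of_sq_le (by rw [norm_residual_zero_sq]; exact h2.le))
    (hnet nP hXP) (hnet nQ hXQ) KP KQ hKτ
  have herr := init_error_le (nQ := nQ) hnP hκ hκc hδ hlamP hlamP1 hlamQ rfl rfl
  have hlast : X ^ 18 * (X ^ 9 / q) = X ^ 27 / q := by ring
  rw [hlast] at hmain
  refine hmain.trans ?_
  gcongr
  rfl
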